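/- **Theorem 5.7 (Asymptotic distributions of $\hat\beta$ and $\tilde\beta$ with $\hat G_{X,n}$).** *Model.* For each sample size $n$ let $Y_i=\mu_i^\star+X_i^T\beta^\star+\epsilon_i$, $1\le i\le n$, with deterministic $\beta^\star\in\mathbb R^{d}$ and $\mu^\star\in\mathbb R^n$, where $d=d_n\to\infty$ and $d=o(n)$. The covariates $X_i$ are i.i.d. copies of a random vector $X_0\in\mathbb R^d$ (whose law may depend on $n$) with mean zero and positive definite covariance matrix $\Sigma_X$; they are independent of the errors $\epsilon_i$, which are i.i.d. copies of a random variable $\epsilon_0$, whose law does not depend on $n$, with mean $0$ and variance $\sigma^2$. There are positive sequences $\kappa_n,\gamma_n=o(\sqrt n)$ with $P(\max_{i}\|X_i\|_2>\kappa_n)\to0$ and $P(\max_i|\epsilon_i|>\gamma_n)\to0$. The incidental parameters satisfy $\min_{i\le s_1}|\mu_i^\star|\gg\max\{\kappa_n,\gamma_n\}$, $0<|\mu_i^\star|\le\gamma_n$ for $s_1<i\le s_1+s_2$, and $\mu_i^\star=0$ for $i>s_1+s_2$, where $s_1=s_{1,n}$ and $s_2=s_{2,n}$ are $o(n)$. Here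 $a\ll b$ and $b\gg a$ mean $a=o(b)$, and a minimum over the empty set is $+\infty$. *Estimators.* The regularization parameter $\lambda=\lambda_n$ satisfies $\sqrt d\,\kappa_n\ll\lambda$, $\alpha\gamma_n\le\lambda$ for a constant $\alpha>2$, and $\lambda\ll\min_{i\le s_1}|\mu_i^\star|$. Let $(\hat\mu,\hat\beta)$ be random vectors that, with probability tending to one, minimize $$L(\mu,\beta)=\sum_{i=1}^n(Y_i-\mu_i-X_i^T\beta)^2+\sum_{i=1}^n2\lambda|\mu_i|$$ over $\mathbb R^n\times\mathbb R^d$. Let $\hat I_0=\{i:\hat\mu_i=0\}$ and let $$\tilde\beta=\Big(\sum_{i\in\hat I_0}X_iX_i^T\Big)^{-1}\sum_{i\in\hat I_0}X_iY_i .$$ *Assumptions.* Let $q$ be a fixed integer, $A_n$ deterministic $q\times d$ matrices, and $G_{X,n}=A_n\Sigma_X^{-1}A_n^T$. Assume: - (B1') $\lambda_{\min}(\Sigma_X)$ is bounded away from zero; - (B2) $d^{-1/2}\|\Sigma_X\|_F$ is bounded; - (C) $d^{-1}\sum_{j=1}^d(\mathbb E X_{0j}^4)^{1/2}$ is finite for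 every $n$ and bounded; - (D) $\|A_n\|_F$ and $\lambda_{\max}(A_nA_n^T)$ are bounded, and $G_{X,n}$ converges in Frobenius norm to a symmetric matrix $G_X$; moreover $G_{X,n}$ is positive definite (that is, $A_n$ has full row rank) for all large $n$; - (E) $\max_j\mathrm{Var}(X_{0j})$ and $\max_j\mathbb E|X_{0j}|^3$ are bounded, and $\min_j\mathrm{Var}(X_{0j})$ is bounded away from zero; - $d^5\log d=o(n)$ and $s_2=o\big(\sqrt n/(\sqrt d\,\kappa_n\gamma_n)\big)$; - $d^8(\log d)^2=o(n)$. Put $\hat\Sigma_X=n^{-1}\sum_{i=1}^nX_iX_i^T$ and $\hat G_{X,n}=A_n\hat\Sigma_X^{-1}A_n^T$. *Conclusion.* 1. If in addition $s_1=o\big(\sqrt n/(\lambda\sqrt d\,\kappa_n)\big)$, then $$\sqrt n\,\hat G_{X,n}^{-1/2}A_n(\hat\beta-\beta^\star)\xrightarrow{d}N(0,\sigma^2I_q).$$ 2. Without this additional condition on $s_1$, $$\sqrt n\,\hat G_{X,n}^{-1/2}A_n(\tilde\beta-\beta^\star)\xrightarrow{d}N(0,\sigma^2I_q).$$ -/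

import Mathlib

open MeasureTheory ProbabilityTheory Filter Topology Asymptotics
open scoped ENNReal NNReal Matrix MatrixOrder

noncomputable section

/-- Frobenius norm of a real matrix. -/
def frobNorm {m n : Type*} [Fintype m] [Fintype n] (A : Matrix m n ℝ) : ℝ :=
  √(∑ i, ∑ j, A i j ^ 2)

/-- Inverse square root `G^{-1/2}` of a positive definite matrix. -/
def invSqrt {q : ℕ} (G : Matrix (Fin q) (Fin q) ℝ) : Matrix (Fin q) (Fin q) ℝ :=
  (CFC.sqrt G)⁻¹

/-- `∑_{i ∈ I} x_i x_iᵀ`. -/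
def gramOn {n d : ℕ} (x : Fin n → EuclideanSpace ℝ (Fin d)) (I : Finset (Fin n)) :
    Matrix (Fin d) (Fin d) ℝ :=
  Matrix.of fun j k => ∑ i ∈ I, x i j * x i k

/-- The uncentred sample covariance matrix `n⁻¹ ∑_i x_i x_iᵀ` (the covariates have mean zero). -/
def sampleCov {n d : ℕ} (x : Fin n → EuclideanSpace ℝ (Fin d)) : Matrix (Fin d) (Fin d) ℝ :=
  (n : ℝ)⁻¹ • gramOn x Finset.univ

/-- The penalized least-squares criterion with soft penalty `2 l |μ_i|`:
`L(μ, β) = ∑_i (y_i - μ_i - x_iᵀβ)² + ∑_i 2 l |μ_i|`. -/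
def penLoss {n d : ℕ} (x : Fin n → EuclideanSpace ℝ (Fin d)) (y : Fin n → ℝ) (l : ℝ)
    (m : Fin n → ℝ) (b : EuclideanSpace ℝ (Fin d)) : ℝ :=
  ∑ i, (y i - m i - inner ℝ (x i) b) ^ 2 + ∑ i, 2 * l * |m i|

/-- `(m, b)` is a global minimizer of the penalized least-squares criterion. -/
def IsPenMinimizer {n d : ℕ} (x : Fin n → EuclideanSpace ℝ (Fin d)) (y : Fin n → ℝ) (l : ℝ)
    (m : Fin n → ℝ) (b : EuclideanSpace ℝ (Fin d)) : Prop :=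
  ∀ (m' : Fin n → ℝ) (b' : EuclideanSpace ℝ (Fin d)), penLoss x y l m b ≤ penLoss x y l m' b'

/-- The ordinary least-squares estimator computed from the observations with index in `I`:
`(X_Iᵀ X_I)⁻¹ X_Iᵀ y_I`. -/
def olsOn {n d : ℕ} (x : Fin n → EuclideanSpace ℝ (Fin d)) (y : Fin n → ℝ)
    (I : Finset (Fin n)) : EuclideanSpace ℝ (Fin d) :=
  WithLp.toLp 2 ((gramOn x I)⁻¹ *ᵥ fun j => ∑ i ∈ I, y i * x i j)

/-- The two-step estimator: least squares on the observations whose estimated incidental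
parameter `m i` vanishes. -/
def twoStep {n d : ℕ} (x : Fin n → EuclideanSpace ℝ (Fin d)) (y : Fin n → ℝ)
    (m : Fin n → ℝ) : EuclideanSpace ℝ (Fin d) :=
  olsOn x y (Finset.univ.filter fun i => m i = 0)

/-- The data of the linear regression model with incidental parameters, as a triangular array:
at sample size `n` the observations are indexed by `Fin n`, the dimension is `d n`, and the
randomness lives on `Ω n`. Observations `i < s₁ n` have large incidental parameters, those with
`s₁ n ≤ i < s₁ n + s₂ n` bounded nonzero ones, and the others have none. -/
structure IncidentalModel (Ω : ℕ → Type*) where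
  /-- number of covariates -/
  d : ℕ → ℕ
  /-- number of large incidental parameters -/
  s₁ : ℕ → ℕ
  /-- number of bounded incidental parameters -/
  s₂ : ℕ → ℕ
  /-- covariates -/
  X : ∀ n, Fin n → Ω n → EuclideanSpace ℝ (Fin (d n))
  /-- random errors -/
  ε : ∀ n, Fin n → Ω n → ℝ
  /-- law of the generic covariate vector `X₀` at sample size `n` -/
  lawX : ∀ n, Measure (EuclideanSpace ℝ (Fin (d n)))
  /-- law of the generic error `ε₀` -/
  lawε : Measure ℝ
  /-- standard deviation of the errors -/
  σ : ℝ
  /-- true incidental parameters -/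
  μStar : ∀ n, Fin n → ℝ
  /-- true structural parameter -/
  βStar : ∀ n, EuclideanSpace ℝ (Fin (d n))
  /-- bound for the covariates -/
  κ : ℕ → ℝ
  /-- bound for the errors -/
  γ : ℕ → ℝ
  /-- regularization parameter -/
  lam : ℕ → ℝ

namespace IncidentalModel

variable {Ω : ℕ → Type*} (M : IncidentalModel Ω)

/-- The responses `Y_i = μ*_i + X_iᵀβ* + ε_i`. -/
def Y (n : ℕ) (ω : Ω n) (i : Fin n) : ℝ :=
  M.μStar n i + inner ℝ (M.X n i ω) (M.βStar n) + M.ε n i ω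

/-- The sample of covariates. -/
def sampleX (n : ℕ) (ω : Ω n) (i : Fin n) : EuclideanSpace ℝ (Fin (M.d n)) := M.X n i ω

/-- The covariance matrix `Σ_X` of `X₀` at sample size `n`. -/
def covX (n : ℕ) : Matrix (Fin (M.d n)) (Fin (M.d n)) ℝ :=
  Matrix.of fun j k => cov[fun x => x j, fun x => x k; M.lawX n]

/-- Standing assumptions of the model with a diverging number of structural parameters. -/
structure Standing [∀ n, MeasurableSpace (Ω n)] (P : ∀ n, Measure (Ω n)) : Prop where
  /-- `d → ∞` and `d ≪ n`. -/
  d_tendsto : Tendsto M.d atTop atTop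
  d_small : (fun n => (M.d n : ℝ)) =o[atTop] fun n => (n : ℝ)
  /-- The covariates are i.i.d. copies of `X₀`, the errors are i.i.d. copies of `ε₀`, and
  covariates and errors are independent. -/
  prob_lawX : ∀ n, IsProbabilityMeasure (M.lawX n)
  prob_lawε : IsProbabilityMeasure M.lawε
  hasLaw_X : ∀ n i, HasLaw (M.X n i) (M.lawX n) (P n)
  hasLaw_ε : ∀ n i, HasLaw (M.ε n i) M.lawε (P n)
  indep_X : ∀ n, iIndepFun (M.X n) (P n)
  indep_ε : ∀ n, iIndepFun (M.ε n) (P n)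
  indep_X_ε : ∀ n, IndepFun (fun ω i => M.X n i ω) (fun ω i => M.ε n i ω) (P n)
  /-- `X₀` has mean zero, finite second moments and a positive definite covariance matrix. -/
  memLp_X : ∀ n j, MemLp (fun x : EuclideanSpace ℝ (Fin (M.d n)) => x j) 2 (M.lawX n)
  mean_X : ∀ n j, ∫ x, x j ∂(M.lawX n) = 0
  posDef_covX : ∀ n, (M.covX n).PosDef
  /-- `ε₀` has mean zero and variance `σ²`. -/
  memLp_ε : MemLp id 2 M.lawε
  mean_ε : ∫ e, e ∂M.lawε = 0
  var_ε : Var[id; M.lawε] = M.σ ^ 2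
  /-- `κ_n`, `γ_n` are positive, `≪ √n`, and dominate the covariates and the errors with
  probability tending to one. -/
  κ_pos : ∀ n, 0 < M.κ n
  γ_pos : ∀ n, 0 < M.γ n
  κ_small : M.κ =o[atTop] fun n => √(n : ℝ)
  γ_small : M.γ =o[atTop] fun n => √(n : ℝ)
  max_X : Tendsto (fun n => P n {ω | ∃ i, M.κ n < ‖M.X n i ω‖}) atTop (𝓝 0)
  max_ε : Tendsto (fun n => P n {ω | ∃ i, M.γ n < |M.ε n i ω|}) atTop (𝓝 0)
  /-- The three kinds of incidental parameters, and their sparsity. -/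
  large : ∀ C : ℝ, ∀ᶠ n in atTop, ∀ i : Fin n, (i : ℕ) < M.s₁ n →
    C * max (M.κ n) (M.γ n) ≤ |M.μStar n i|
  bounded : ∀ n, ∀ i : Fin n, M.s₁ n ≤ (i : ℕ) → (i : ℕ) < M.s₁ n + M.s₂ n →
    M.μStar n i ≠ 0 ∧ |M.μStar n i| ≤ M.γ n
  zero : ∀ n, ∀ i : Fin n, M.s₁ n + M.s₂ n ≤ (i : ℕ) → M.μStar n i = 0
  s₁_small : (fun n => (M.s₁ n : ℝ)) =o[atTop] fun n => (n : ℝ)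
  s₂_small : (fun n => (M.s₂ n : ℝ)) =o[atTop] fun n => (n : ℝ)

/-- Specification of the regularization parameter: `√d κ_n ≪ λ`, `α γ_n ≤ λ` for a constant
`α > 2`, and `λ ≪ min_{i ≤ s₁} |μ*_i|`. -/
structure RegSpec : Prop where
  lower : (fun n => √(M.d n : ℝ) * M.κ n) =o[atTop] M.lam
  ratio : ∃ α : ℝ, 2 < α ∧ ∀ n, α * M.γ n ≤ M.lam n
  upper : ∀ C : ℝ, ∀ᶠ n in atTop, ∀ i : Fin n, (i : ℕ) < M.s₁ n →
    C * M.lam n ≤ |M.μStar n i|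

/-- Assumption (B1'): `λ_min(Σ_X)` is bounded away from zero. -/
def AssumptionB1' : Prop :=
  ∃ c : ℝ, 0 < c ∧ ∀ n, ∀ t : ℝ,
    Module.End.HasEigenvalue (Matrix.toLin' (M.covX n)) t → c ≤ t

/-- Assumption (B2): `d^{-1/2} ‖Σ_X‖_F` is bounded. -/
def AssumptionB2 : Prop :=
  ∃ C : ℝ, ∀ n, (√(M.d n : ℝ))⁻¹ * frobNorm (M.covX n) ≤ C

/-- Assumption (C): `κ_X = d⁻¹ ∑_j (E X_{0j}⁴)^{1/2}` is (finite and) bounded. -/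
def AssumptionC : Prop :=
  (∀ n j, MemLp (fun x : EuclideanSpace ℝ (Fin (M.d n)) => x j) 4 (M.lawX n)) ∧
  ∃ C : ℝ, ∀ n, (M.d n : ℝ)⁻¹ * ∑ j, √(∫ x, x j ^ 4 ∂(M.lawX n)) ≤ C

/-- Assumption (E): the marginal variances are bounded above and bounded away from zero, and
the marginal third absolute moments are (finite and) bounded above. -/
def AssumptionE : Prop :=
  (∃ C : ℝ, ∀ n j, Var[fun x => x j; M.lawX n] ≤ C) ∧
  (∃ C : ℝ, ∀ n j, Integrable (fun x => |x j| ^ 3) (M.lawX n) ∧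
    ∫ x, |x j| ^ 3 ∂(M.lawX n) ≤ C) ∧
  ∃ c : ℝ, 0 < c ∧ ∀ n j, c ≤ Var[fun x => x j; M.lawX n]

variable {q : ℕ} (A : ∀ n, Matrix (Fin q) (Fin (M.d n)) ℝ)

/-- `G_{X,n} = A_n Σ_X⁻¹ A_nᵀ`. -/
def GX (n : ℕ) : Matrix (Fin q) (Fin q) ℝ := A n * (M.covX n)⁻¹ * (A n)ᵀ

/-- The plug-in estimator of `G_{X,n}`: `A_n Σ̂⁻¹ A_nᵀ` with the sample covariance matrix `Σ̂`. -/
def GXhat (n : ℕ) (ω : Ω n) : Matrix (Fin q) (Fin q) ℝ :=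
  A n * (sampleCov (M.sampleX n ω))⁻¹ * (A n)ᵀ

/-- Assumption (D): `‖A_n‖_F` and `λ_max(A_n A_nᵀ)` are bounded and `G_{X,n}` converges in
Frobenius norm to a symmetric matrix. -/
def AssumptionD : Prop :=
  (∃ C : ℝ, ∀ n, frobNorm (A n) ≤ C) ∧
  (∃ C : ℝ, ∀ n, ∀ t : ℝ,
    Module.End.HasEigenvalue (Matrix.toLin' (A n * (A n)ᵀ)) t → t ≤ C) ∧
  ∃ G : Matrix (Fin q) (Fin q) ℝ, G.IsSymm ∧
    Tendsto (fun n => frobNorm (M.GX A n - G)) atTop (𝓝 0)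

/-- The studentized linear map `√n Ĝ_{X,n}^{-1/2} A_n (b - β*)` of an estimator `b` of `β*`. -/
def studentized (n : ℕ) (b : Ω n → EuclideanSpace ℝ (Fin (M.d n))) (ω : Ω n) :
    EuclideanSpace ℝ (Fin q) :=
  WithLp.toLp 2 (√(n : ℝ) • (invSqrt (M.GXhat A n ω) *ᵥ
    (A n *ᵥ WithLp.ofLp (b ω - M.βStar n))))

end IncidentalModel

end

noncomputable section

/-! Let `I` be the set of observations without a large incidental parameter. With probability
tending to one the penalized problem can be solved explicitly. On `I` every estimated incidental
parameter is zero. Off `I` it is a residual soft-thresholded with the sign of the true parameter.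
Hence the estimation error is the inverse Gram matrix of `I` applied to three scores: errors,
bounded parameters, and `λ` times signs of large parameters. The guess is verified by the
first-order conditions (`IsPenMinimizer.eq_of_separation`). These conditions hold strictly on `I`,
where the Gram matrix is positive definite, so every minimizer equals the guess. Chebyshev bounds
make each score's contribution to a fitted value a small multiple of `λ`.

Least squares on the estimated zero set is then least squares on `I`. Its error has the same form
without the sign score, which explains why only the penalized estimator needs a condition on `s₁`.

Both estimators are thus covered by `Standing.tendstoInDistribution_studentized`. Paired with a
fixed `t`, the studentized error is `∑ c_i ε_i + o(1)` with weights depending on the covariates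
alone. Computed with the full Gram matrix, the squared weights would sum to exactly `‖t‖²`, because
the studentization uses the sample covariance. Since `s₁ = o(n)`, restricting to `I` changes this by
a factor tending to one (`inverse_form_compare`, `gram_compare`). Each weight is at most of order
`κ_n / √n`. A central limit theorem for weighted sums, obtained by integrating out the errors given
the covariates, concludes. -/

/-! ### Gram matrices, inverse quadratic forms and inverse square roots. -/

theorem dotProduct_gramOn_mulVec {n d : ℕ} (x : Fin n → EuclideanSpace ℝ (Fin d))
    (I : Finset (Fin n)) (v w : EuclideanSpace ℝ (Fin d)) :
    v.ofLp ⬝ᵥ (gramOn x I *ᵥ w.ofLp) = ∑ i ∈ I, inner ℝ (x i) v * inner ℝ (x i) w := by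
  have h1 : ∀ i ∈ I, inner ℝ (x i) v * inner ℝ (x i) w
      = ∑ j, ∑ k, v j * (x i j * x i k * w k) := by
    intro i _
    simp only [PiLp.inner_apply, RCLike.inner_apply, conj_trivial, Finset.sum_mul_sum]
    refine Finset.sum_congr rfl fun j _ => Finset.sum_congr rfl fun k _ => by ring
  rw [Finset.sum_congr rfl h1, Finset.sum_comm]
  simp only [dotProduct, Matrix.mulVec, gramOn, Matrix.of_apply, Finset.mul_sum, Finset.sum_mul]
  refine Finset.sum_congr rfl fun j _ => ?_
  rw [Finset.sum_comm]

theorem gramOn_isSymm {n d : ℕ} (x : Fin n → EuclideanSpace ℝ (Fin d)) (I : Finset (Fin n)) :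
    (gramOn x I)ᵀ = gramOn x I := by
  ext j k
  simp [gramOn, mul_comm]

theorem gramOn_posSemidef {n d : ℕ} (x : Fin n → EuclideanSpace ℝ (Fin d))
    (I : Finset (Fin n)) : (gramOn x I).PosSemidef := by
  refine Matrix.PosSemidef.of_dotProduct_mulVec_nonneg
    (by rw [Matrix.IsHermitian, Matrix.conjTranspose_eq_transpose_of_trivial, gramOn_isSymm])
    fun v => ?_
  have := dotProduct_gramOn_mulVec x I (WithLp.toLp 2 v) (WithLp.toLp 2 v)
  simp only [star_trivial]
  rw [this]
  exact Finset.sum_nonneg fun i _ => mul_self_nonneg _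

theorem gramOn_posDef {n d : ℕ} (x : Fin n → EuclideanSpace ℝ (Fin d))
    (I : Finset (Fin n)) {c : ℝ} (hc : 0 < c)
    (h : ∀ v, c * ‖v‖ ^ 2 ≤ ∑ i ∈ I, inner ℝ (x i) v ^ 2) : (gramOn x I).PosDef := by
  refine Matrix.PosDef.of_dotProduct_mulVec_pos (gramOn_posSemidef x I).1 fun v hv => ?_
  have := dotProduct_gramOn_mulVec x I (WithLp.toLp 2 v) (WithLp.toLp 2 v)
  simp only [star_trivial]
  rw [this]
  simp only [← sq]
  refine lt_of_lt_of_le ?_ (h _)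
  have : 0 < ‖WithLp.toLp 2 v‖ := norm_pos_iff.2 (by simpa using hv)
  positivity

/-- The inverse Gram matrix applied to a vector. -/
def gramSolve {n d : ℕ} (x : Fin n → EuclideanSpace ℝ (Fin d)) (I : Finset (Fin n))
    (a : EuclideanSpace ℝ (Fin d)) : EuclideanSpace ℝ (Fin d) :=
  WithLp.toLp 2 ((gramOn x I)⁻¹ *ᵥ a.ofLp)

theorem inner_eq_ofLp_dotProduct {d : ℕ} (a w : EuclideanSpace ℝ (Fin d)) :
    inner ℝ a w = a.ofLp ⬝ᵥ w.ofLp := by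
  simp [PiLp.inner_apply, dotProduct, mul_comm]

theorem gramSolve_spec {n d : ℕ} {x : Fin n → EuclideanSpace ℝ (Fin d)}
    {I : Finset (Fin n)} (h : (gramOn x I).PosDef) (a w : EuclideanSpace ℝ (Fin d)) :
    ∑ i ∈ I, inner ℝ (x i) w * inner ℝ (x i) (gramSolve x I a) = inner ℝ a w := by
  rw [← dotProduct_gramOn_mulVec, gramSolve, Matrix.mulVec_mulVec,
    Matrix.mul_nonsing_inv _ ((Matrix.isUnit_iff_isUnit_det _).1 h.isUnit), Matrix.one_mulVec,
    inner_eq_ofLp_dotProduct, dotProduct_comm]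

theorem eq_gramSolve {n d : ℕ} {x : Fin n → EuclideanSpace ℝ (Fin d)}
    {I : Finset (Fin n)} (h : (gramOn x I).PosDef) (a b : EuclideanSpace ℝ (Fin d))
    (hb : gramOn x I *ᵥ b.ofLp = a.ofLp) : b = gramSolve x I a := by
  rw [gramSolve, ← hb, Matrix.mulVec_mulVec,
    Matrix.nonsing_inv_mul _ ((Matrix.isUnit_iff_isUnit_det _).1 h.isUnit), Matrix.one_mulVec]

theorem inner_gramSolve_comm {n d : ℕ} (x : Fin n → EuclideanSpace ℝ (Fin d))
    (I : Finset (Fin n)) (a b : EuclideanSpace ℝ (Fin d)) :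
    inner ℝ a (gramSolve x I b) = inner ℝ (gramSolve x I a) b := by
  rw [inner_eq_ofLp_dotProduct, inner_eq_ofLp_dotProduct]
  simp only [gramSolve]
  rw [Matrix.dotProduct_mulVec, ← Matrix.mulVec_transpose, Matrix.transpose_nonsing_inv,
    gramOn_isSymm]

/-- Inversion reverses the order of positive definite forms. This follows from the variational
formula `aᵀG⁻¹a = max_w (2 aᵀw - wᵀGw)`, tested at one well-chosen `w` in each direction. -/
theorem inverse_form_compare {n d : ℕ} {x : Fin n → EuclideanSpace ℝ (Fin d)}
    {I : Finset (Fin n)} {c η : ℝ} (hc : 0 < c) (hη1 : η < 1)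
    (hlow : ∀ v, c * ‖v‖ ^ 2 ≤ ∑ i ∈ I, inner ℝ (x i) v ^ 2)
    (hrel : ∀ v, (1 - η) * ∑ i, inner ℝ (x i) v ^ 2 ≤ ∑ i ∈ I, inner ℝ (x i) v ^ 2)
    (a : EuclideanSpace ℝ (Fin d)) :
    inner ℝ a (gramSolve x Finset.univ a) ≤ inner ℝ a (gramSolve x I a) ∧
    (1 - η) * inner ℝ a (gramSolve x I a) ≤ inner ℝ a (gramSolve x Finset.univ a) := by
  have hle : ∀ v, ∑ i ∈ I, inner ℝ (x i) v ^ 2 ≤ ∑ i, inner ℝ (x i) v ^ 2 := fun v =>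
    Finset.sum_le_sum_of_subset_of_nonneg (Finset.subset_univ _) fun _ _ _ => sq_nonneg _
  have hI := gramOn_posDef x I hc hlow
  have hU := gramOn_posDef x Finset.univ hc fun v => (hlow v).trans (hle v)
  set p := gramSolve x Finset.univ a with hp
  set g := gramSolve x I a with hg
  -- The variational bound, by completing the square around the maximizer `gramSolve x J a`.
  have key : ∀ (J : Finset (Fin n)), (gramOn x J).PosDef → ∀ w,
      2 * inner ℝ a w - ∑ i ∈ J, inner ℝ (x i) w ^ 2 ≤ inner ℝ a (gramSolve x J a) := by
    intro J hJ w
    have h1 := gramSolve_spec hJ a w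
    have h2 := gramSolve_spec hJ a (gramSolve x J a)
    have h3 : 0 ≤ ∑ i ∈ J, (inner ℝ (x i) w - inner ℝ (x i) (gramSolve x J a)) ^ 2 :=
      Finset.sum_nonneg fun _ _ => sq_nonneg _
    have h4 : ∑ i ∈ J, (inner ℝ (x i) w - inner ℝ (x i) (gramSolve x J a)) ^ 2
        = ∑ i ∈ J, inner ℝ (x i) w ^ 2
          - 2 * ∑ i ∈ J, inner ℝ (x i) w * inner ℝ (x i) (gramSolve x J a)
          + ∑ i ∈ J, inner ℝ (x i) (gramSolve x J a) * inner ℝ (x i) (gramSolve x J a) := by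
      rw [Finset.mul_sum, ← Finset.sum_sub_distrib, ← Finset.sum_add_distrib]
      exact Finset.sum_congr rfl fun _ _ => by ring
    rw [h4, h1, h2] at h3
    linarith
  have hpp : ∑ i, inner ℝ (x i) p ^ 2 = inner ℝ a p := by
    rw [← gramSolve_spec hU a p]; simp [sq, hp]
  have hgg : ∑ i ∈ I, inner ℝ (x i) g ^ 2 = inner ℝ a g := by
    rw [← gramSolve_spec hI a g]; simp [sq, hg]
  constructor
  · have := key I hI p
    have := hle p
    linarith
  -- The maximizer for `(1 - η)⁻¹` times the form on `I` is `(1 - η) • g`, hence this test vector.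
  · have h1 := key Finset.univ hU ((1 - η) • g)
    simp only [inner_smul_right, mul_pow, ← Finset.mul_sum] at h1
    have h2 := hrel g
    have h3 : (1 - η) * ((1 - η) * ∑ i, inner ℝ (x i) g ^ 2) ≤ (1 - η) * inner ℝ a g :=
      mul_le_mul_of_nonneg_left (by linarith) (by linarith)
    nlinarith

theorem invSqrt_transpose {q : ℕ} (G : Matrix (Fin q) (Fin q) ℝ) :
    (invSqrt G)ᵀ = invSqrt G := by
  have h : (CFC.sqrt G).PosSemidef := Matrix.nonneg_iff_posSemidef.1 (CFC.sqrt_nonneg G)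
  have h2 : (CFC.sqrt G)ᵀ = CFC.sqrt G := by
    have := h.1
    rwa [Matrix.IsHermitian, Matrix.conjTranspose_eq_transpose_of_trivial] at this
  rw [invSqrt, Matrix.transpose_nonsing_inv, h2]

theorem invSqrt_mul_mul {q : ℕ} {G : Matrix (Fin q) (Fin q) ℝ} (hG : G.PosDef) :
    invSqrt G * G * invSqrt G = 1 := by
  have h0 : 0 ≤ G := Matrix.nonneg_iff_posSemidef.2 hG.posSemidef
  have hs : CFC.sqrt G * CFC.sqrt G = G := CFC.sqrt_mul_sqrt_self G h0
  have hdet : IsUnit (CFC.sqrt G).det := by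
    have : IsUnit G.det := (Matrix.isUnit_iff_isUnit_det _).1 hG.isUnit
    rw [← hs, Matrix.det_mul] at this
    exact isUnit_of_mul_isUnit_left this
  rw [invSqrt]
  nth_rewrite 2 [← hs]
  rw [← Matrix.mul_assoc, Matrix.nonsing_inv_mul _ hdet, Matrix.one_mul,
    Matrix.mul_nonsing_inv _ hdet]

/-! ### Optimality conditions for the penalized criterion. -/

/-- `hle` and `hsub` say that the residual is `l` times a subgradient of the ℓ¹ norm at `m0`. The
excess loss over a stationary point is then a sum of two nonnegative terms, so both vanish at a
minimizer. Strictness on `I` forces `m` and `m0` to vanish there; the quadratic term then identifies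
`b` through `hpd`, and finally `m`. -/
theorem IsPenMinimizer.eq_of_stationary {n d : ℕ} {x : Fin n → EuclideanSpace ℝ (Fin d)}
    {y : Fin n → ℝ} {l : ℝ} {m m0 : Fin n → ℝ} {b b0 : EuclideanSpace ℝ (Fin d)}
    (I : Finset (Fin n))
    (hscore : ∀ w, ∑ i, (y i - m0 i - inner ℝ (x i) b0) * inner ℝ (x i) w = 0)
    (hle : ∀ i, |y i - m0 i - inner ℝ (x i) b0| ≤ l)
    (hsub : ∀ i, (y i - m0 i - inner ℝ (x i) b0) * m0 i = l * |m0 i|)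
    (hstrict : ∀ i ∈ I, |y i - m0 i - inner ℝ (x i) b0| < l)
    (hpd : ∀ v, (∀ i ∈ I, inner ℝ (x i) v = 0) → v = 0)
    (h : IsPenMinimizer x y l m b) : m = m0 ∧ b = b0 := by
  set e : Fin n → ℝ := fun i => y i - m0 i - inner ℝ (x i) b0 with he
  change ∀ w, ∑ i, e i * inner ℝ (x i) w = 0 at hscore
  change ∀ i, |e i| ≤ l at hle
  change ∀ i, e i * m0 i = l * |m0 i| at hsub
  change ∀ i ∈ I, |e i| < l at hstrict
  set u : Fin n → ℝ := fun i => m i - m0 i + inner ℝ (x i) (b - b0) with hu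
  have hem : ∀ i, e i * m i ≤ l * |m i| := fun i => by
    calc e i * m i ≤ |e i * m i| := le_abs_self _
      _ = |e i| * |m i| := abs_mul _ _
      _ ≤ l * |m i| := mul_le_mul_of_nonneg_right (hle i) (abs_nonneg _)
  -- The term linear in `b - b0` is removed by the score equation, the one linear in `m0` by `hsub`.
  have hdiff : penLoss x y l m b - penLoss x y l m0 b0
      = ∑ i, u i ^ 2 + 2 * ∑ i, (l * |m i| - e i * m i) := by
    have h1 : penLoss x y l m b - penLoss x y l m0 b0 + 2 * ∑ i, e i * inner ℝ (x i) (b - b0)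
        = ∑ i, u i ^ 2 + 2 * ∑ i, (l * |m i| - e i * m i) := by
      simp only [penLoss, Finset.mul_sum, ← Finset.sum_add_distrib, ← Finset.sum_sub_distrib]
      refine Finset.sum_congr rfl fun i _ => ?_
      have hs := hsub i
      simp only [hu, he, inner_sub_right] at hs ⊢
      linear_combination 2 * hs
    rw [hscore, mul_zero, add_zero] at h1
    exact h1
  have hmin := h m0 b0
  have hn1 : 0 ≤ ∑ i, u i ^ 2 := Finset.sum_nonneg fun _ _ => sq_nonneg _
  have hn2 : 0 ≤ ∑ i, (l * |m i| - e i * m i) :=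
    Finset.sum_nonneg fun i _ => sub_nonneg.2 (hem i)
  have hz1 : ∑ i, u i ^ 2 = 0 := by linarith
  have hz2 : ∑ i, (l * |m i| - e i * m i) = 0 := by linarith
  rw [Finset.sum_eq_zero_iff_of_nonneg fun _ _ => sq_nonneg _] at hz1
  rw [Finset.sum_eq_zero_iff_of_nonneg fun i _ => sub_nonneg.2 (hem i)] at hz2
  have hzero : ∀ i ∈ I, ∀ t : ℝ, e i * t = l * |t| → t = 0 := by
    intro i hi t ht
    by_contra hne
    have h1 : 0 < |t| := abs_pos.2 hne
    have h2 : e i * t ≤ |e i| * |t| := by rw [← abs_mul]; exact le_abs_self _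
    nlinarith [hstrict i hi]
  have hb : b = b0 := by
    refine sub_eq_zero.1 (hpd _ fun i hi => ?_)
    have h1 := hz1 i (Finset.mem_univ i)
    have h2 := hzero i hi (m i) (by linarith [hz2 i (Finset.mem_univ i)])
    have h3 := hzero i hi (m0 i) (hsub i)
    have h4 : u i = 0 := by simpa using h1
    simp only [hu, h2, h3] at h4
    linarith
  refine ⟨funext fun i => ?_, hb⟩
  have h4 : u i = 0 := by simpa using hz1 i (Finset.mem_univ i)
  simp only [hu, hb, sub_self, inner_zero_right, add_zero] at h4
  linarith

/-- A primal-dual witness argument. The candidate has residual `μ i + ε i - xᵀδ` on `I` and `l *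
sign (μ i)` off `I`, so `hδ` is its score equation. `hI` keeps the first residuals strictly below
the threshold. `hJ` makes the signal so large that off `I` the candidate keeps the sign of `μ i`. -/
theorem IsPenMinimizer.eq_of_separation {n d : ℕ} {x : Fin n → EuclideanSpace ℝ (Fin d)}
    {μ ε : Fin n → ℝ} {l θ : ℝ} {m : Fin n → ℝ} {β b δ : EuclideanSpace ℝ (Fin d)}
    (I : Finset (Fin n)) (hl : 0 < l)
    (hδ : ∀ w, ∑ i ∈ I, inner ℝ (x i) w * inner ℝ (x i) δ
      = ∑ i ∈ I, (μ i + ε i) * inner ℝ (x i) w + ∑ i ∈ Iᶜ, l * (μ i).sign * inner ℝ (x i) w)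
    (hθ : ∀ i, |inner ℝ (x i) δ| ≤ θ)
    (hI : ∀ i ∈ I, |μ i + ε i| + θ < l)
    (hJ : ∀ i ∈ Iᶜ, |ε i| + θ + l < |μ i|)
    (hpd : ∀ v, (∀ i ∈ I, inner ℝ (x i) v = 0) → v = 0)
    (h : IsPenMinimizer x (fun i => μ i + inner ℝ (x i) β + ε i) l m b) :
    b = β + δ ∧ ∀ i, m i = 0 ↔ i ∈ I := by
  classical
  set m0 : Fin n → ℝ := fun i =>
    if i ∈ I then 0 else μ i + ε i - inner ℝ (x i) δ - l * (μ i).sign with hm0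
  have e1 : ∀ i ∈ I, μ i + inner ℝ (x i) β + ε i - m0 i - inner ℝ (x i) (β + δ)
      = μ i + ε i - inner ℝ (x i) δ := fun i hi => by
    simp only [hm0, if_pos hi, inner_add_right]; ring
  have e2 : ∀ i ∈ Iᶜ, μ i + inner ℝ (x i) β + ε i - m0 i - inner ℝ (x i) (β + δ)
      = l * (μ i).sign := fun i hi => by
    simp only [hm0, if_neg (Finset.mem_compl.1 hi), inner_add_right]; ring
  have a1 : ∀ i ∈ I, |μ i + ε i - inner ℝ (x i) δ| < l := fun i hi => by
    have := abs_sub (μ i + ε i) (inner ℝ (x i) δ)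
    linarith [hI i hi, hθ i]
  have hsign : ∀ i ∈ Iᶜ, |m0 i| = (μ i).sign * m0 i ∧ m0 i ≠ 0 ∧ |(μ i).sign| = 1 := by
    intro i hi
    have h1 := hJ i hi
    have h2 := abs_le.1 (hθ i)
    have h3 := abs_le.1 (le_refl |ε i|)
    have h4 := (abs_nonneg (ε i))
    have h5 := (abs_nonneg _).trans (hθ i)
    simp only [hm0, if_neg (Finset.mem_compl.1 hi)]
    rcases lt_trichotomy (μ i) 0 with hμ | hμ | hμ
    · rw [abs_of_neg hμ] at h1
      rw [Real.sign_of_neg hμ]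
      have : μ i + ε i - inner ℝ (x i) δ - l * -1 < 0 := by linarith
      rw [abs_of_neg this]
      exact ⟨by ring, this.ne, by simp⟩
    · rw [hμ, abs_zero] at h1; linarith
    · rw [abs_of_pos hμ] at h1
      rw [Real.sign_of_pos hμ]
      have : 0 < μ i + ε i - inner ℝ (x i) δ - l * 1 := by linarith
      rw [abs_of_pos this]
      exact ⟨by ring, this.ne', by simp⟩
  have key := IsPenMinimizer.eq_of_stationary (m0 := m0) (b0 := β + δ) I ?_ ?_ ?_ ?_ hpd h
  · refine ⟨key.2, fun i => ?_⟩
    rw [key.1]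
    constructor
    · intro h0
      by_contra hi
      exact (hsign i (Finset.mem_compl.2 hi)).2.1 h0
    · intro hi
      simp [hm0, hi]
  · intro w
    rw [← Finset.sum_add_sum_compl I, Finset.sum_congr rfl fun i hi => by rw [e1 i hi],
      Finset.sum_congr (s₁ := Iᶜ) rfl fun i hi => by rw [e2 i hi]]
    have := hδ w
    simp only [sub_mul, Finset.sum_sub_distrib]
    have h2 : ∑ i ∈ I, inner ℝ (x i) δ * inner ℝ (x i) w
        = ∑ i ∈ I, inner ℝ (x i) w * inner ℝ (x i) δ :=
      Finset.sum_congr rfl fun _ _ => mul_comm _ _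
    linarith
  · intro i
    by_cases hi : i ∈ I
    · rw [e1 i hi]; exact (a1 i hi).le
    · rw [e2 i (Finset.mem_compl.2 hi), abs_mul, (hsign i (Finset.mem_compl.2 hi)).2.2,
        abs_of_pos hl, mul_one]
  · intro i
    by_cases hi : i ∈ I
    · simp [hm0, hi]
    · rw [e2 i (Finset.mem_compl.2 hi), (hsign i (Finset.mem_compl.2 hi)).1, mul_assoc]
  · intro i hi
    rw [e1 i hi]; exact a1 i hi

/-! ### Events of probability tending to one. -/

/-- `p n` holds with probability tending to one. -/
def WHP {Ω : ℕ → Type*} [∀ n, MeasurableSpace (Ω n)] (P : ∀ n, Measure (Ω n))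
    (p : ∀ n, Ω n → Prop) : Prop :=
  Tendsto (fun n => P n {ω | ¬ p n ω}) atTop (𝓝 0)

namespace WHP

variable {Ω : ℕ → Type*} [∀ n, MeasurableSpace (Ω n)] {P : ∀ n, Measure (Ω n)}
  {p r : ∀ n, Ω n → Prop}

theorem and (hp : WHP P p) (hr : WHP P r) : WHP P fun n ω => p n ω ∧ r n ω := by
  refine tendsto_of_tendsto_of_tendsto_of_le_of_le tendsto_const_nhds
    (by simpa using Tendsto.add hp hr) (fun n => zero_le) fun n => ?_
  refine (measure_mono ?_).trans (measure_union_le _ _)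
  intro ω hω
  simp only [Set.mem_ofPred_eq, Set.mem_union] at hω ⊢
  tauto

theorem mono (hp : WHP P p) (h : ∀ᶠ n in atTop, ∀ ω, p n ω → r n ω) : WHP P r := by
  refine tendsto_of_tendsto_of_tendsto_of_le_of_le' tendsto_const_nhds hp
    (Eventually.of_forall fun n => zero_le) ?_
  filter_upwards [h] with n hn
  exact measure_mono fun ω hω hr => hω (hn ω hr)

theorem of_le_ofReal {u : ℕ → ℝ} (hu : Tendsto u atTop (𝓝 0))
    (h : ∀ᶠ n in atTop, P n {ω | ¬ p n ω} ≤ ENNReal.ofReal (u n)) : WHP P p :=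
  tendsto_of_tendsto_of_tendsto_of_le_of_le' tendsto_const_nhds
    (by simpa using ENNReal.tendsto_ofReal hu) (Eventually.of_forall fun n => zero_le) h

theorem tendsto_integral [∀ n, IsProbabilityMeasure (P n)] {f : ∀ n, Ω n → ℝ} {K : ℝ}
    (hf : ∀ n, AEMeasurable (f n) (P n)) (h0 : ∀ n ω, 0 ≤ f n ω) (hK : ∀ n ω, f n ω ≤ K)
    (h : ∀ η > 0, WHP P fun n ω => f n ω ≤ η) :
    Tendsto (fun n => ∫ ω, f n ω ∂P n) atTop (𝓝 0) := by
  rw [Metric.tendsto_atTop']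
  intro η hη
  have h1 : Tendsto (fun n => (P n {ω | ¬ f n ω ≤ η / 2}).toReal * K) atTop (𝓝 0) := by
    simpa using ((ENNReal.tendsto_toReal ENNReal.zero_ne_top).comp (h (η / 2) (by linarith))).mul_const K
  obtain ⟨N, hN⟩ := eventually_atTop.1 (h1.eventually (gt_mem_nhds (half_pos hη)))
  refine ⟨N, fun n hn => ?_⟩
  have hs : NullMeasurableSet {ω | ¬ f n ω ≤ η / 2} (P n) := by
    simp only [not_le]
    exact nullMeasurableSet_lt aemeasurable_const (hf n)
  have hint : Integrable (f n) (P n) :=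
    Integrable.of_bound (hf n).aestronglyMeasurable K
      (Eventually.of_forall fun ω => by rw [Real.norm_of_nonneg (h0 n ω)]; exact hK n ω)
  have hle : ∫ ω, f n ω ∂P n ≤ ∫ ω, (η / 2 + {ω | ¬ f n ω ≤ η / 2}.indicator (fun _ => K) ω) ∂P n := by
    refine integral_mono hint ((integrable_const _).add ?_) fun ω => ?_
    · exact (integrable_const K).indicator₀ hs
    · by_cases hω : f n ω ≤ η / 2
      · simp [hω]
      · have := hK n ω
        simp only [Set.indicator, Set.mem_ofPred_eq, hω, not_false_eq_true, if_true]
        linarith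
  rw [integral_add (integrable_const _)
    ((integrable_const K).indicator₀ hs),
    integral_indicator₀ hs] at hle
  simp only [integral_const, probReal_univ, smul_eq_mul, one_mul] at hle
  rw [Real.dist_0_eq_abs, abs_of_nonneg (integral_nonneg (h0 n))]
  have h2 := hN n hn.le
  simp only [measureReal_def, Measure.restrict_apply_univ] at hle
  linarith

end WHP

/-! ### Central limit theorem for randomly weighted sums. -/

theorem norm_prod_sub_prod_le {ι : Type*} (s : Finset ι) {a b : ι → ℂ}
    (ha : ∀ i, ‖a i‖ ≤ 1) (hb : ∀ i, ‖b i‖ ≤ 1) :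
    ‖∏ i ∈ s, a i - ∏ i ∈ s, b i‖ ≤ ∑ i ∈ s, ‖a i - b i‖ := by
  classical
  induction s using Finset.induction_on with
  | empty => simp
  | insert i s hi ih =>
    rw [Finset.prod_insert hi, Finset.prod_insert hi, Finset.sum_insert hi]
    have h1 : ‖∏ j ∈ s, b j‖ ≤ 1 := by
      rw [norm_prod]
      exact Finset.prod_le_one (fun _ _ => norm_nonneg _) fun j _ => hb j
    calc ‖a i * ∏ j ∈ s, a j - b i * ∏ j ∈ s, b j‖
        = ‖a i * (∏ j ∈ s, a j - ∏ j ∈ s, b j) + (a i - b i) * ∏ j ∈ s, b j‖ := by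
          congr 1; ring
      _ ≤ ‖a i‖ * ‖∏ j ∈ s, a j - ∏ j ∈ s, b j‖ + ‖a i - b i‖ * ‖∏ j ∈ s, b j‖ := by
          rw [← norm_mul, ← norm_mul]; exact norm_add_le _ _
      _ ≤ 1 * (∑ j ∈ s, ‖a j - b j‖) + ‖a i - b i‖ * 1 := by
          gcongr
          exact ha i
      _ = _ := by ring

/-- Two moments give a second-order Taylor expansion of the characteristic function at zero. It
agrees with that of the Gaussian up to `o(s²)`. -/
theorem exists_charFun_sub_exp_le {μ : Measure ℝ} [IsProbabilityMeasure μ] {σ : ℝ}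
    (h2 : MemLp id 2 μ) (hmean : ∫ e, e ∂μ = 0) (hvar : Var[id; μ] = σ ^ 2) {η : ℝ} (hη : 0 < η) :
    ∃ δ > 0, ∀ s : ℝ, |s| ≤ δ →
      ‖charFun μ s - Complex.exp ((-(σ ^ 2 * s ^ 2 / 2) : ℝ))‖ ≤ η * s ^ 2 := by
  have hsq : ∫ e, e ^ 2 ∂μ = σ ^ 2 := by
    rw [← hvar, variance_of_integral_eq_zero aemeasurable_id (by simpa using hmean)]
    rfl
  have ht : (fun s : ℝ => charFun μ s - (1 - σ ^ 2 * s ^ 2 / 2 : ℝ)) =o[𝓝 0] fun s => s ^ 2 := by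
    have h := taylorWithinEval_charFun_two_zero (X := id) (P := μ) aemeasurable_id
      (by simpa using h2)
    have h' : ∀ t : ℝ, taylorWithinEval (charFun μ) 2 Set.univ 0 t = (1 - σ ^ 2 * t ^ 2 / 2 : ℝ) := by
      intro t
      have := h t
      simp only [Measure.map_id, id_eq, hmean, Pi.pow_apply, hsq] at this
      rw [this]; push_cast; ring
    have h3 := taylor_isLittleO_univ (f := charFun μ) (x₀ := (0 : ℝ)) (n := 2)
      (contDiff_charFun (by exact_mod_cast h2))
    simpa only [h', sub_zero] using h3
  have he : (fun s : ℝ => ((1 - σ ^ 2 * s ^ 2 / 2 : ℝ) : ℂ)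
      - Complex.exp ((-(σ ^ 2 * s ^ 2 / 2) : ℝ))) =o[𝓝 0] fun s => s ^ 2 := by
    have hO : (fun s : ℝ => ((1 - σ ^ 2 * s ^ 2 / 2 : ℝ) : ℂ)
      - Complex.exp ((-(σ ^ 2 * s ^ 2 / 2) : ℝ))) =O[𝓝 0] fun s => (s ^ 2) * (s ^ 2) := by
      refine IsBigO.of_bound ((σ ^ 2 / 2) ^ 2) ?_
      have hev : ∀ᶠ s : ℝ in 𝓝 0, |-(σ ^ 2 * s ^ 2 / 2)| < 1 := by
        have : Tendsto (fun s : ℝ => |-(σ ^ 2 * s ^ 2 / 2)|) (𝓝 0) (𝓝 0) := by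
          have hc : Continuous fun s : ℝ => |-(σ ^ 2 * s ^ 2 / 2)| := by fun_prop
          simpa using hc.tendsto 0
        exact this.eventually (gt_mem_nhds one_pos)
      filter_upwards [hev] with s hs
      have h := Real.abs_exp_sub_one_sub_id_le hs.le
      rw [← Complex.ofReal_exp, ← Complex.ofReal_sub, Complex.norm_real, Real.norm_eq_abs,
        abs_sub_comm]
      calc _ = |Real.exp (-(σ ^ 2 * s ^ 2 / 2)) - 1 - -(σ ^ 2 * s ^ 2 / 2)| := by
            congr 1; ring
        _ ≤ _ := h
        _ = _ := by rw [Real.norm_of_nonneg (by positivity)]; ring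
    refine hO.trans_isLittleO ?_
    have : (fun s : ℝ => s ^ 2 * s ^ 2) =o[𝓝 0] fun s : ℝ => (1 : ℝ) * s ^ 2 := by
      refine IsLittleO.mul_isBigO ?_ (isBigO_refl _ _)
      rw [isLittleO_one_iff]
      have hc : Continuous fun s : ℝ => s ^ 2 := by fun_prop
      simpa using hc.tendsto 0
    simpa using this
  have hsum := ht.add he
  simp only [sub_add_sub_cancel] at hsum
  obtain ⟨δ, hδ, hb⟩ := Metric.eventually_nhds_iff.1 (hsum.def hη)
  refine ⟨δ / 2, half_pos hδ, fun s hs => ?_⟩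
  have := hb (y := s) (by rw [Real.dist_0_eq_abs]; linarith)
  rwa [Real.norm_of_nonneg (sq_nonneg s)] at this

/-- Telescoping the product adds up the single-factor errors `η c_i²`. The radius `δ` does not
depend on `n`, which is what a triangular array requires. -/
theorem exists_prod_charFun_sub_exp_le {μ : Measure ℝ} [IsProbabilityMeasure μ] {σ : ℝ}
    (h2 : MemLp id 2 μ) (hmean : ∫ e, e ∂μ = 0) (hvar : Var[id; μ] = σ ^ 2) {η : ℝ} (hη : 0 < η) :
    ∃ δ > 0, ∀ (n : ℕ) (c : Fin n → ℝ), (∀ i, |c i| ≤ δ) →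
      ‖∏ i, charFun μ (c i) - Complex.exp ((-(σ ^ 2 * (∑ i, c i ^ 2) / 2) : ℝ))‖
        ≤ η * ∑ i, c i ^ 2 := by
  obtain ⟨δ, hδ, h⟩ := exists_charFun_sub_exp_le h2 hmean hvar hη
  refine ⟨δ, hδ, fun n c hc => ?_⟩
  have he : Complex.exp ((-(σ ^ 2 * (∑ i, c i ^ 2) / 2) : ℝ))
      = ∏ i, Complex.exp ((-(σ ^ 2 * c i ^ 2 / 2) : ℝ)) := by
    rw [← Complex.exp_sum, ← Complex.ofReal_sum]
    congr 2
    rw [Finset.sum_neg_distrib, Finset.mul_sum, Finset.sum_div]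
  rw [he]
  refine (norm_prod_sub_prod_le _ (fun i => norm_charFun_le_one _) fun i => ?_).trans ?_
  · rw [← Complex.ofReal_exp, Complex.norm_real, Real.norm_of_nonneg (Real.exp_pos _).le,
      Real.exp_le_one_iff]
    have : 0 ≤ σ ^ 2 * c i ^ 2 := by positivity
    linarith
  · rw [Finset.mul_sum]
    exact Finset.sum_le_sum fun i _ => h _ (hc i)

/-- Fubini on the joint law: given the covariates the weights are constants and the integral over
the independent errors factorizes. -/
theorem integral_exp_sum_mul_eq {Ω 𝒳 : Type*} [MeasurableSpace Ω] [MeasurableSpace 𝒳]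
    {P : Measure Ω} [IsProbabilityMeasure P] {μ : Measure ℝ} [IsProbabilityMeasure μ] {n : ℕ}
    {X : Ω → 𝒳} {ε : Fin n → Ω → ℝ} (hX : AEMeasurable X P) (hε : ∀ i, HasLaw (ε i) μ P)
    (hind : iIndepFun ε P) (hXε : IndepFun X (fun ω i => ε i ω) P)
    {c : 𝒳 → Fin n → ℝ} (hc : Measurable c) :
    ∫ ω, Complex.exp ((∑ i, c (X ω) i * ε i ω : ℝ) * Complex.I) ∂P
      = ∫ ω, ∏ i, charFun μ (c (X ω) i) ∂P := by
  have hεm : AEMeasurable (fun ω i => ε i ω) P :=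
    aemeasurable_pi_lambda _ fun i => (hε i).aemeasurable
  have hprod := (indepFun_iff_map_prod_eq_prod_map_map hX hεm).1 hXε
  have hpi : P.map (fun ω i => ε i ω) = Measure.pi fun _ => μ := by
    rw [(iIndepFun_iff_map_fun_eq_pi_map fun i => (hε i).aemeasurable).1 hind]
    simp [fun i => (hε i).map_eq]
  have hXp : IsProbabilityMeasure (P.map X) := Measure.isProbabilityMeasure_map hX
  have hm : Measurable fun z : 𝒳 × (Fin n → ℝ) =>
      Complex.exp ((∑ i, c z.1 i * z.2 i : ℝ) * Complex.I) := by
    have : ∀ i, Measurable fun z : 𝒳 × (Fin n → ℝ) => c z.1 i * z.2 i := fun i => by fun_prop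
    fun_prop
  have h1 : ∫ ω, Complex.exp ((∑ i, c (X ω) i * ε i ω : ℝ) * Complex.I) ∂P
      = ∫ z, Complex.exp ((∑ i, c z.1 i * z.2 i : ℝ) * Complex.I)
        ∂(P.map fun ω => (X ω, fun i => ε i ω)) := by
    rw [integral_map (hX.prodMk hεm) hm.aestronglyMeasurable]
  have hcf : Measurable (charFun μ) := by
    have : Continuous (charFun μ) := continuous_charFun
    exact this.measurable
  rw [h1, hprod, hpi, integral_prod]
  · have h2 : ∀ x : 𝒳, ∫ e : Fin n → ℝ, Complex.exp ((∑ i, c x i * e i : ℝ) * Complex.I)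
        ∂(Measure.pi fun _ => μ) = ∏ i, charFun μ (c x i) := by
      intro x
      have h3 : ∀ e : Fin n → ℝ, Complex.exp ((∑ i, c x i * e i : ℝ) * Complex.I)
          = ∏ i, Complex.exp ((c x i) * (e i) * Complex.I) := fun e => by
        rw [← Complex.exp_sum, ← Finset.sum_mul]; push_cast; rfl
      simp_rw [h3]
      rw [integral_fintype_prod_eq_prod (f := fun i (e : ℝ) =>
        Complex.exp ((c x i : ℂ) * e * Complex.I))]
      simp [charFun_apply_real]
    simp_rw [h2]
    rw [integral_map hX]
    exact (Finset.measurable_prod _ fun i _ =>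
      hcf.comp ((measurable_pi_apply i).comp hc)).aestronglyMeasurable
  · refine Integrable.of_bound hm.aestronglyMeasurable 1 (Eventually.of_forall fun z => ?_)
    rw [Complex.norm_exp_ofReal_mul_I]

theorem norm_exp_mul_I_sub_exp_mul_I_le (a b : ℝ) :
    ‖Complex.exp (a * Complex.I) - Complex.exp (b * Complex.I)‖ ≤ |a - b| := by
  have h : Complex.exp (a * Complex.I) - Complex.exp (b * Complex.I)
      = Complex.exp (b * Complex.I) * (Complex.exp (Complex.I * ((a - b : ℝ) : ℂ)) - 1) := by
    rw [mul_sub, ← Complex.exp_add, mul_one]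
    congr 2
    push_cast; ring
  rw [h, norm_mul, Complex.norm_exp_ofReal_mul_I, one_mul]
  exact Real.norm_exp_I_mul_ofReal_sub_one_le

/-- Central limit theorem for randomly weighted sums of i.i.d. errors, with asymptotically
negligible weights that are independent of the errors. -/
theorem tendstoInDistribution_of_weighted_sum {Ω 𝒳 : ℕ → Type*} [∀ n, MeasurableSpace (Ω n)]
    [∀ n, MeasurableSpace (𝒳 n)] {P : ∀ n, Measure (Ω n)} [∀ n, IsProbabilityMeasure (P n)]
    {μ : Measure ℝ} [IsProbabilityMeasure μ] {σ : ℝ}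
    (h2 : MemLp id 2 μ) (hmean : ∫ e, e ∂μ = 0) (hvar : Var[id; μ] = σ ^ 2)
    {X : ∀ n, Ω n → 𝒳 n} {ε : ∀ n, Fin n → Ω n → ℝ} (hX : ∀ n, AEMeasurable (X n) (P n))
    (hε : ∀ n i, HasLaw (ε n i) μ (P n)) (hind : ∀ n, iIndepFun (ε n) (P n))
    (hXε : ∀ n, IndepFun (X n) (fun ω i => ε n i ω) (P n))
    {q : ℕ} {T : ∀ n, Ω n → EuclideanSpace ℝ (Fin q)} (hT : ∀ n, AEMeasurable (T n) (P n))
    {c : EuclideanSpace ℝ (Fin q) → ∀ n, 𝒳 n → Fin n → ℝ} (hc : ∀ t n, Measurable (c t n))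
    (happrox : ∀ t, ∀ η > 0, WHP P fun n ω =>
      |inner ℝ (T n ω) t - ∑ i, c t n (X n ω) i * ε n i ω| ≤ η)
    (hsmall : ∀ t, ∀ η > 0, WHP P fun n ω => ∀ i, |c t n (X n ω) i| ≤ η)
    (hnorm : ∀ t, ∀ η > 0, WHP P fun n ω => |∑ i, c t n (X n ω) i ^ 2 - ‖t‖ ^ 2| ≤ η) :
    TendstoInDistribution T atTop id P
      (multivariateGaussian 0 (σ ^ 2 • (1 : Matrix (Fin q) (Fin q) ℝ))) where
  forall_aemeasurable := hT
  tendsto := by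
    refine ProbabilityMeasure.tendsto_iff_tendsto_charFun.2 fun t => ?_
    have hpsd : (σ ^ 2 • (1 : Matrix (Fin q) (Fin q) ℝ)).PosSemidef :=
      Matrix.PosSemidef.one.smul (sq_nonneg σ)
    have hlim : charFun (multivariateGaussian 0 (σ ^ 2 • (1 : Matrix (Fin q) (Fin q) ℝ))) t
        = Complex.exp ((-(σ ^ 2 * ‖t‖ ^ 2 / 2) : ℝ)) := by
      rw [charFun_multivariateGaussian hpsd]
      congr 1
      rw [EuclideanSpace.real_norm_sq_eq]
      simp [Matrix.smul_mulVec, dotProduct, Finset.mul_sum, Finset.sum_div]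
      exact Finset.sum_congr rfl fun _ _ => by ring
    simp only [ProbabilityMeasure.coe_mk, Measure.map_id, hlim]
    rw [tendsto_iff_norm_sub_tendsto_zero]
    set L : ℂ := Complex.exp ((-(σ ^ 2 * ‖t‖ ^ 2 / 2) : ℝ)) with hL
    have hLn : ‖L‖ ≤ 1 := by
      rw [hL, ← Complex.ofReal_exp, Complex.norm_real, Real.norm_of_nonneg (Real.exp_pos _).le,
        Real.exp_le_one_iff]
      have : 0 ≤ σ ^ 2 * ‖t‖ ^ 2 := by positivity
      linarith
    have hεm : ∀ n i, AEMeasurable (ε n i) (P n) := fun n i => (hε n i).aemeasurable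
    have hcm : ∀ n i, AEMeasurable (fun ω => c t n (X n ω) i) (P n) := fun n i =>
      ((measurable_pi_apply i).comp (hc t n)).comp_aemeasurable (hX n)
    have hcf : Measurable (charFun μ) := by
      have : Continuous (charFun μ) := continuous_charFun
      exact this.measurable
    have m1 : ∀ n, AEMeasurable (fun ω => Complex.exp ((inner ℝ (T n ω) t : ℝ) * Complex.I)) (P n) :=
      fun n => by have := hT n; fun_prop
    have m2 : ∀ n, AEMeasurable (fun ω =>
        Complex.exp ((∑ i, c t n (X n ω) i * ε n i ω : ℝ) * Complex.I)) (P n) := fun n => by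
      have := hεm n
      have := hcm n
      fun_prop
    have m3 : ∀ n, AEMeasurable (fun ω => ∏ i, charFun μ (c t n (X n ω) i)) (P n) := fun n =>
      Finset.aemeasurable_fun_prod _ fun i _ => hcf.comp_aemeasurable (hcm n i)
    have n3 : ∀ n ω, ‖∏ i, charFun μ (c t n (X n ω) i)‖ ≤ 1 := fun n ω => by
      rw [norm_prod]
      exact Finset.prod_le_one (fun _ _ => norm_nonneg _) fun j _ => norm_charFun_le_one _
    have i1 : ∀ n, Integrable
        (fun ω => Complex.exp ((inner ℝ (T n ω) t : ℝ) * Complex.I)) (P n) := fun n =>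
      Integrable.of_bound (m1 n).aestronglyMeasurable 1 (Eventually.of_forall fun ω => by
        rw [Complex.norm_exp_ofReal_mul_I])
    have i2 : ∀ n, Integrable (fun ω =>
        Complex.exp ((∑ i, c t n (X n ω) i * ε n i ω : ℝ) * Complex.I)) (P n) := fun n =>
      Integrable.of_bound (m2 n).aestronglyMeasurable 1 (Eventually.of_forall fun ω => by
        rw [Complex.norm_exp_ofReal_mul_I])
    have i3 : ∀ n, Integrable (fun ω => ∏ i, charFun μ (c t n (X n ω) i)) (P n) := fun n =>
      Integrable.of_bound (m3 n).aestronglyMeasurable 1 (Eventually.of_forall (n3 n))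
    -- The distance to the limit splits into replacing the statistic by the weighted sum (`f1`), and
    -- the product of characteristic functions by its Gaussian limit (`f2`). Both are bounded by 2
    -- and tend to zero in probability, hence in mean.
    set f1 : ∀ n, Ω n → ℝ := fun n ω => ‖Complex.exp ((inner ℝ (T n ω) t : ℝ) * Complex.I)
      - Complex.exp ((∑ i, c t n (X n ω) i * ε n i ω : ℝ) * Complex.I)‖ with hf1
    set f2 : ∀ n, Ω n → ℝ := fun n ω => ‖∏ i, charFun μ (c t n (X n ω) i) - L‖ with hf2
    have t1 : Tendsto (fun n => ∫ ω, f1 n ω ∂P n) atTop (𝓝 0) := by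
      refine WHP.tendsto_integral (K := 2) (fun n => ((m1 n).sub (m2 n)).norm)
        (fun n ω => norm_nonneg _) (fun n ω => ?_) fun η hη => ?_
      · refine (norm_sub_le _ _).trans ?_
        rw [Complex.norm_exp_ofReal_mul_I, Complex.norm_exp_ofReal_mul_I]
        norm_num
      · exact (happrox t η hη).mono (Eventually.of_forall fun n ω hω =>
          (norm_exp_mul_I_sub_exp_mul_I_le _ _).trans hω)
    have t2 : Tendsto (fun n => ∫ ω, f2 n ω ∂P n) atTop (𝓝 0) := by
      refine WHP.tendsto_integral (K := 2) (fun n => ((m3 n).sub aemeasurable_const).norm)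
        (fun n ω => norm_nonneg _) (fun n ω => ?_) fun η hη => ?_
      · refine (norm_sub_le _ _).trans ?_
        linarith [n3 n ω]
      · have hcont : Continuous fun s : ℝ => Complex.exp ((-(σ ^ 2 * s / 2) : ℝ)) := by fun_prop
        obtain ⟨ρ, hρ, hρ'⟩ := Metric.continuousAt_iff.1 (hcont.continuousAt (x := ‖t‖ ^ 2))
          (η / 2) (half_pos hη)
        -- In `min (ρ / 2) 1` below, `ρ / 2` serves continuity in the variance; the `1` keeps `∑
        -- c_i²` below `‖t‖² + 1`, so that the product error is at most `η / 2`.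
        have hB : 0 < ‖t‖ ^ 2 + 1 := by positivity
        obtain ⟨δ, hδ, hpr⟩ := exists_prod_charFun_sub_exp_le h2 hmean hvar
          (div_pos (half_pos hη) hB)
        refine ((hsmall t δ hδ).and (hnorm t (min (ρ / 2) 1) (by positivity))).mono
          (Eventually.of_forall fun n ω hω => ?_)
        obtain ⟨hω1, hω2⟩ := hω
        have b1 := hpr n _ hω1
        have b2 := hρ' (x := ∑ i, c t n (X n ω) i ^ 2) (by
          rw [Real.dist_eq]
          linarith [min_le_left (ρ / 2) 1])
        rw [dist_eq_norm] at b2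
        have b3 : ∑ i, c t n (X n ω) i ^ 2 ≤ ‖t‖ ^ 2 + 1 := by
          linarith [(abs_le.1 hω2).2, min_le_right (ρ / 2) 1]
        have b4 : η / 2 / (‖t‖ ^ 2 + 1) * ∑ i, c t n (X n ω) i ^ 2 ≤ η / 2 := by
          calc _ ≤ η / 2 / (‖t‖ ^ 2 + 1) * (‖t‖ ^ 2 + 1) := by gcongr
            _ = η / 2 := by field_simp
        calc f2 n ω ≤ _ := norm_sub_le_norm_sub_add_norm_sub _
              (Complex.exp ((-(σ ^ 2 * (∑ i, c t n (X n ω) i ^ 2) / 2) : ℝ))) _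
          _ ≤ η / 2 + η / 2 := add_le_add (b1.trans b4) b2.le
          _ = η := by ring
    refine squeeze_zero (fun _ => norm_nonneg _) (fun n => ?_) (by simpa using t1.add t2)
    have e1 : charFun ((P n).map (T n)) t
        = ∫ ω, Complex.exp ((inner ℝ (T n ω) t : ℝ) * Complex.I) ∂P n := by
      rw [charFun_apply, integral_map (hT n)]
      have : Continuous fun x : EuclideanSpace ℝ (Fin q) =>
        Complex.exp ((inner ℝ x t : ℝ) * Complex.I) := by fun_prop
      exact this.aestronglyMeasurable
    have e2 := integral_exp_sum_mul_eq (hX n) (hε n) (hind n) (hXε n) (hc t n)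
    have e3 : charFun ((P n).map (T n)) t - L
        = ∫ ω, (Complex.exp ((inner ℝ (T n ω) t : ℝ) * Complex.I)
          - Complex.exp ((∑ i, c t n (X n ω) i * ε n i ω : ℝ) * Complex.I)) ∂P n
          + ∫ ω, (∏ i, charFun μ (c t n (X n ω) i) - L) ∂P n := by
      rw [integral_sub (i1 n) (i2 n), integral_sub (i3 n) (integrable_const _), e1, e2]
      simp
    rw [e3]
    exact (norm_add_le _ _).trans
      (add_le_add (norm_integral_le_integral_norm _) (norm_integral_le_integral_norm _))

/-! ### The studentizing direction and its weights. -/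

theorem inner_toLp_smul_mulVec {q d : ℕ} {H : Matrix (Fin q) (Fin q) ℝ} (hH : Hᵀ = H)
    (A : Matrix (Fin q) (Fin d) ℝ) (r : ℝ) (v : EuclideanSpace ℝ (Fin d))
    (t : EuclideanSpace ℝ (Fin q)) :
    inner ℝ (WithLp.toLp 2 (r • (H *ᵥ (A *ᵥ v.ofLp))) : EuclideanSpace ℝ (Fin q)) t
      = inner ℝ (WithLp.toLp 2 (r • (Aᵀ *ᵥ (H *ᵥ t.ofLp))) : EuclideanSpace ℝ (Fin d)) v := by
  rw [inner_eq_ofLp_dotProduct, inner_eq_ofLp_dotProduct]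
  simp only [smul_dotProduct]
  congr 1
  rw [dotProduct_comm, Matrix.dotProduct_mulVec, Matrix.dotProduct_mulVec,
    ← Matrix.mulVec_transpose, ← Matrix.mulVec_transpose, hH]

/-- Positive definiteness with any middle matrix `B` already forces `A` to have full row rank. This
transfers invertibility from the population matrix `G_{X,n}` to its plug-in version. -/
theorem posDef_mul_inv_mul_transpose {q d : ℕ} {A : Matrix (Fin q) (Fin d) ℝ}
    {B S : Matrix (Fin d) (Fin d) ℝ} (hB : (A * B * Aᵀ).PosDef) (hS : S.PosDef) :
    (A * S⁻¹ * Aᵀ).PosDef := by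
  have hinj : Function.Injective A.vecMul := by
    refine (injective_iff_map_eq_zero (Matrix.vecMulLinear A)).2 fun v hv => ?_
    by_contra hne
    have h1 := hB.dotProduct_mulVec_pos hne
    have h2 : Aᵀ *ᵥ v = 0 := by rw [Matrix.mulVec_transpose]; exact hv
    rw [← Matrix.mulVec_mulVec, h2] at h1
    simp at h1
  have := hS.inv.mul_mul_conjTranspose_same hinj
  rwa [Matrix.conjTranspose_eq_transpose_of_trivial] at this

/-- The plug-in matrix `A Σ̂⁻¹ Aᵀ`. -/
def plugIn {n d q : ℕ} (A : Matrix (Fin q) (Fin d) ℝ) (x : Fin n → EuclideanSpace ℝ (Fin d)) :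
    Matrix (Fin q) (Fin q) ℝ :=
  A * (sampleCov x)⁻¹ * Aᵀ

/-- The direction `√n Aᵀ (A Σ̂⁻¹ Aᵀ)^{-1/2} t`. -/
def studDir {n d q : ℕ} (A : Matrix (Fin q) (Fin d) ℝ) (x : Fin n → EuclideanSpace ℝ (Fin d))
    (t : EuclideanSpace ℝ (Fin q)) : EuclideanSpace ℝ (Fin d) :=
  WithLp.toLp 2 (√(n : ℝ) • (Aᵀ *ᵥ (invSqrt (plugIn A x) *ᵥ t.ofLp)))

/-- The factors of `n` cancel, leaving `tᵀ Ĝ^{-1/2} Ĝ Ĝ^{-1/2} t`. The identity is exact, with no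
passage to the limit of `Ĝ`. -/
theorem inner_studDir_gramSolve {n d q : ℕ} (hn : 0 < n) {A : Matrix (Fin q) (Fin d) ℝ}
    {x : Fin n → EuclideanSpace ℝ (Fin d)} (hG : (plugIn A x).PosDef)
    (t : EuclideanSpace ℝ (Fin q)) :
    inner ℝ (studDir A x t) (gramSolve x Finset.univ (studDir A x t)) = ‖t‖ ^ 2 := by
  have hn' : (n : ℝ) ≠ 0 := by positivity
  -- No invertibility is needed: for a singular Gram matrix both sides are zero by the convention
  -- for `⁻¹`.
  have hinv : (sampleCov x)⁻¹ = (n : ℝ) • (gramOn x Finset.univ)⁻¹ := by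
    rw [sampleCov]
    by_cases hdet : IsUnit (gramOn x Finset.univ).det
    · rw [show (n : ℝ)⁻¹ = (((Units.mk0 (n : ℝ) hn')⁻¹ : ℝˣ) : ℝ) by simp]
      rw [← Units.smul_def, Matrix.inv_smul' _ (Units.mk0 (n : ℝ) hn')⁻¹ hdet]
      simp [Units.smul_def]
    · rw [Matrix.nonsing_inv_apply_not_isUnit _ hdet, Matrix.nonsing_inv_apply_not_isUnit]
      · simp
      · rw [Matrix.det_smul]
        intro h
        exact hdet (isUnit_of_mul_isUnit_right h)
  set H := invSqrt (plugIn A x) with hH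
  have h1 : (n : ℝ) • (A *ᵥ ((gramOn x Finset.univ)⁻¹ *ᵥ (Aᵀ *ᵥ (H *ᵥ t.ofLp))))
      = plugIn A x *ᵥ (H *ᵥ t.ofLp) := by
    rw [plugIn, hinv]
    simp only [Matrix.mul_smul, Matrix.smul_mul, Matrix.smul_mulVec, Matrix.mulVec_mulVec,
      Matrix.mul_assoc]
  have h2 : inner ℝ (studDir A x t) (gramSolve x Finset.univ (studDir A x t))
      = inner ℝ (WithLp.toLp 2 (√(n : ℝ) • (H *ᵥ (A *ᵥ (gramSolve x Finset.univ
        (studDir A x t)).ofLp))) : EuclideanSpace ℝ (Fin q)) t := by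
    rw [inner_toLp_smul_mulVec (invSqrt_transpose _)]
    rfl
  have h3 : √(n : ℝ) • (H *ᵥ (A *ᵥ (gramSolve x Finset.univ (studDir A x t)).ofLp))
      = t.ofLp := by
    simp only [gramSolve, studDir, Matrix.mulVec_smul, smul_smul]
    rw [Real.mul_self_sqrt (Nat.cast_nonneg n), ← Matrix.mulVec_smul, ← hH, h1,
      Matrix.mulVec_mulVec, Matrix.mulVec_mulVec,
      invSqrt_mul_mul hG, Matrix.one_mulVec]
  rw [h2, h3]
  simp

/-- The squared weights sum to the inverse form `s` of `I`, which `inverse_form_compare` traps by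
`‖t‖² ≤ s` and `(1 - η) s ≤ ‖t‖²`. With `η ≤ 1/2` this gives `s ≤ 2‖t‖²`, whence both bounds. -/
theorem studDir_weights {n d q : ℕ} (hn : 0 < n) {A : Matrix (Fin q) (Fin d) ℝ}
    {x : Fin n → EuclideanSpace ℝ (Fin d)} (hG : (plugIn A x).PosDef)
    {I : Finset (Fin n)} {c η : ℝ} (hc : 0 < c) (hη1 : η ≤ 1 / 2)
    (hlow : ∀ v, c * n * ‖v‖ ^ 2 ≤ ∑ i ∈ I, inner ℝ (x i) v ^ 2)
    (hrel : ∀ v, (1 - η) * ∑ i, inner ℝ (x i) v ^ 2 ≤ ∑ i ∈ I, inner ℝ (x i) v ^ 2)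
    (t : EuclideanSpace ℝ (Fin q)) :
    |∑ i ∈ I, inner ℝ (x i) (gramSolve x I (studDir A x t)) ^ 2 - ‖t‖ ^ 2| ≤ 2 * η * ‖t‖ ^ 2 ∧
    ‖gramSolve x I (studDir A x t)‖ ^ 2 ≤ 2 * ‖t‖ ^ 2 / (c * n) := by
  have hcn : 0 < c * n := by positivity
  have hI := gramOn_posDef x I hcn hlow
  obtain ⟨h1, h2⟩ := inverse_form_compare hcn (by linarith) hlow hrel (studDir A x t)
  rw [inner_studDir_gramSolve hn hG] at h1 h2
  have h3 : ∑ i ∈ I, inner ℝ (x i) (gramSolve x I (studDir A x t)) ^ 2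
      = inner ℝ (studDir A x t) (gramSolve x I (studDir A x t)) := by
    rw [← gramSolve_spec hI (studDir A x t)]; simp [sq]
  have h4 := hlow (gramSolve x I (studDir A x t))
  rw [h3] at h4 ⊢
  set s := inner ℝ (studDir A x t) (gramSolve x I (studDir A x t))
  have h5 : s ≤ 2 * ‖t‖ ^ 2 := by nlinarith [sq_nonneg ‖t‖]
  constructor
  · rw [abs_of_nonneg (by linarith)]
    have h6 : 0 ≤ s := (sq_nonneg _).trans h1
    by_cases hη : 0 ≤ η
    · nlinarith
    -- For negative `η` the two comparisons force `s = 0` and `t = 0`.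
    · have := sq_nonneg ‖t‖
      nlinarith
  · rw [le_div_iff₀ hcn]; linarith

/-! ### Measurability of the estimators and of the studentized statistic. -/

theorem measurable_nonsing_inv_apply {α : Type*} [MeasurableSpace α] {m : ℕ}
    {G : α → Matrix (Fin m) (Fin m) ℝ} (hG : ∀ j k, Measurable fun a => G a j k) (j k : Fin m) :
    Measurable fun a => (G a)⁻¹ j k := by
  have hm : Measurable (β := Fin m → Fin m → ℝ) G :=
    measurable_pi_lambda _ fun j => measurable_pi_lambda _ fun k => hG j k
  have h1 : Continuous fun B : Fin m → Fin m → ℝ => Matrix.det (B : Matrix (Fin m) (Fin m) ℝ) :=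
    Continuous.matrix_det continuous_id
  have h2 : Continuous fun B : Fin m → Fin m → ℝ =>
      Matrix.adjugate (B : Matrix (Fin m) (Fin m) ℝ) j k :=
    (continuous_apply_apply j k).comp
      (Continuous.matrix_adjugate (A := fun B : Fin m → Fin m → ℝ =>
        (B : Matrix (Fin m) (Fin m) ℝ)) continuous_id)
  have h3 : (fun a => (G a)⁻¹ j k) = fun a => (G a).det⁻¹ * (G a).adjugate j k := by
    ext a
    rw [Matrix.inv_def, Matrix.smul_apply, Ring.inverse_eq_inv', smul_eq_mul]
  rw [h3]
  exact ((h1.measurable.comp hm).inv).mul (h2.measurable.comp hm)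

theorem measurable_mul_apply {α : Type*} [MeasurableSpace α] {l m k : ℕ}
    {B : α → Matrix (Fin l) (Fin m) ℝ} {C : α → Matrix (Fin m) (Fin k) ℝ}
    (hB : ∀ i j, Measurable fun a => B a i j) (hC : ∀ i j, Measurable fun a => C a i j)
    (i : Fin l) (j : Fin k) : Measurable fun a => (B a * C a) i j := by
  simp only [Matrix.mul_apply]
  exact Finset.measurable_sum _ fun r _ => (hB i r).mul (hC r j)

/-- Squaring is continuous and injective on the closed cone of positive semidefinite matrices, hence
a measurable embedding by Lusin–Souslin. The square root is its inverse. -/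
theorem measurable_sqrt_apply {α : Type*} [MeasurableSpace α] {m : ℕ}
    {G : α → Matrix (Fin m) (Fin m) ℝ} (hG : ∀ j k, Measurable fun a => G a j k)
    (hpsd : ∀ a, (G a).PosSemidef) (j k : Fin m) :
    Measurable fun a => CFC.sqrt (G a) j k := by
  have hm : Measurable (β := Fin m → Fin m → ℝ) G :=
    measurable_pi_lambda _ fun j => measurable_pi_lambda _ fun k => hG j k
  let s : Set (Fin m → Fin m → ℝ) := {B | (Matrix.of B).PosSemidef}
  let F : (Fin m → Fin m → ℝ) → (Fin m → Fin m → ℝ) := fun B =>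
    ((Matrix.of B : Matrix (Fin m) (Fin m) ℝ) * (Matrix.of B : Matrix (Fin m) (Fin m) ℝ) :
      Matrix (Fin m) (Fin m) ℝ)
  have hof : Continuous fun B : Fin m → Fin m → ℝ => (Matrix.of B : Matrix (Fin m) (Fin m) ℝ) :=
    continuous_id
  have hs : IsClosed s := by
    have : s = {B | (Matrix.of B)ᵀ = Matrix.of B} ∩
        ⋂ v : Fin m → ℝ, {B | 0 ≤ v ⬝ᵥ (Matrix.of B *ᵥ v)} := by
      ext B
      simp only [s, Set.mem_ofPred_eq, Set.mem_inter_iff, Set.mem_iInter,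
        Matrix.posSemidef_iff_dotProduct_mulVec, Matrix.IsHermitian,
        Matrix.conjTranspose_eq_transpose_of_trivial, star_trivial]
    rw [this]
    refine (isClosed_eq hof.matrix_transpose hof).inter (isClosed_iInter fun v => ?_)
    exact isClosed_le continuous_const
      (continuous_const.dotProduct (hof.matrix_mulVec continuous_const))
  have hF : Continuous F := hof.mul hof
  have hinj : Set.InjOn F s := by
    intro B hB C hC h
    have h' : (Matrix.of B : Matrix (Fin m) (Fin m) ℝ) * Matrix.of B
      = Matrix.of C * Matrix.of C := h
    have e1 : CFC.sqrt ((Matrix.of B : Matrix (Fin m) (Fin m) ℝ) * Matrix.of B) = Matrix.of B :=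
      CFC.sqrt_mul_self _ (Matrix.nonneg_iff_posSemidef.2 hB)
    have e2 : CFC.sqrt ((Matrix.of C : Matrix (Fin m) (Fin m) ℝ) * Matrix.of C) = Matrix.of C :=
      CFC.sqrt_mul_self _ (Matrix.nonneg_iff_posSemidef.2 hC)
    exact Matrix.of.injective (e1.symm.trans ((congrArg CFC.sqrt h').trans e2))
  have hemb := hF.continuousOn.measurableEmbedding hs.measurableSet hinj
  let g : α → s := fun a => ⟨(CFC.sqrt (G a) : Matrix (Fin m) (Fin m) ℝ),
    Matrix.nonneg_iff_posSemidef.1 (CFC.sqrt_nonneg (G a))⟩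
  have hg : Measurable g := by
    rw [← hemb.measurable_comp_iff]
    have hFg : s.domRestrict F ∘ g = G := funext fun a =>
      CFC.sqrt_mul_sqrt_self (G a) (Matrix.nonneg_iff_posSemidef.2 (hpsd a))
    rw [hFg]
    exact hm
  exact (measurable_pi_apply k).comp ((measurable_pi_apply j).comp (measurable_subtype_coe.comp hg))

theorem measurable_gramOn_apply {α : Type*} [MeasurableSpace α] {n d : ℕ}
    {x : α → Fin n → EuclideanSpace ℝ (Fin d)} (hx : Measurable x) {I : α → Finset (Fin n)}
    (hI : ∀ i, MeasurableSet {a | i ∈ I a}) (j k : Fin d) :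
    Measurable fun a => gramOn (x a) (I a) j k := by
  classical
  have h : (fun a => gramOn (x a) (I a) j k)
      = fun a => ∑ i, if i ∈ I a then x a i j * x a i k else 0 := by
    ext a
    simp [gramOn]
  rw [h]
  refine Finset.measurable_sum _ fun i _ => Measurable.ite (hI i) ?_ measurable_const
  have : ∀ l, Measurable fun a => x a i l := fun l => by
    have := (measurable_pi_apply i).comp hx
    fun_prop
  exact (this j).mul (this k)

theorem plugIn_posSemidef {n d q : ℕ} (A : Matrix (Fin q) (Fin d) ℝ)
    (x : Fin n → EuclideanSpace ℝ (Fin d)) : (plugIn A x).PosSemidef := by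
  have h : (sampleCov x).PosSemidef := (gramOn_posSemidef x Finset.univ).smul (by positivity)
  have := h.inv.mul_mul_conjTranspose_same A
  rwa [Matrix.conjTranspose_eq_transpose_of_trivial] at this

theorem measurable_invSqrt_plugIn_apply {n d q : ℕ} (A : Matrix (Fin q) (Fin d) ℝ)
    (j k : Fin q) :
    Measurable fun x : Fin n → EuclideanSpace ℝ (Fin d) => invSqrt (plugIn A x) j k := by
  refine measurable_nonsing_inv_apply (fun j k => measurable_sqrt_apply (fun j k => ?_)
    (plugIn_posSemidef A) j k) j k
  refine measurable_mul_apply (C := fun _ => Aᵀ) (measurable_mul_apply (B := fun _ => A) (fun _ _ => measurable_const)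
    (measurable_nonsing_inv_apply fun j k => ?_)) (fun _ _ => measurable_const) j k
  simp only [sampleCov, Matrix.smul_apply, smul_eq_mul]
  exact (measurable_gramOn_apply (I := fun _ => Finset.univ) measurable_id
    (fun i => MeasurableSet.const _) j k).const_mul _

theorem measurable_toLp_mulVec {α : Type*} [MeasurableSpace α] {m k : ℕ}
    {B : α → Matrix (Fin m) (Fin k) ℝ} {v : α → Fin k → ℝ}
    (hB : ∀ i j, Measurable fun a => B a i j) (hv : ∀ i, Measurable fun a => v a i) :
    Measurable fun a => (WithLp.toLp 2 (B a *ᵥ v a) : EuclideanSpace ℝ (Fin m)) := by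
  refine (WithLp.measurable_toLp 2 _).comp (measurable_pi_lambda _ fun i => ?_)
  simp only [Matrix.mulVec, dotProduct]
  exact Finset.measurable_sum _ fun j _ => (hB i j).mul (hv j)

theorem measurable_mulVec_apply {α : Type*} [MeasurableSpace α] {m k : ℕ}
    {B : α → Matrix (Fin m) (Fin k) ℝ} {v : α → Fin k → ℝ}
    (hB : ∀ i j, Measurable fun a => B a i j) (hv : ∀ i, Measurable fun a => v a i) (i : Fin m) :
    Measurable fun a => (B a *ᵥ v a) i := by
  simp only [Matrix.mulVec, dotProduct]
  exact Finset.measurable_sum _ fun j _ => (hB i j).mul (hv j)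

theorem measurable_gramSolve_studDir {n d q : ℕ} (A : Matrix (Fin q) (Fin d) ℝ)
    (I : Finset (Fin n)) (t : EuclideanSpace ℝ (Fin q)) :
    Measurable fun x : Fin n → EuclideanSpace ℝ (Fin d) => gramSolve x I (studDir A x t) := by
  refine measurable_toLp_mulVec (measurable_nonsing_inv_apply
    (measurable_gramOn_apply (I := fun _ => I) measurable_id fun i => MeasurableSet.const _))
    fun i => ?_
  simp only [studDir, Pi.smul_apply, smul_eq_mul]
  refine Measurable.const_mul ?_ _
  exact measurable_mulVec_apply (B := fun _ => Aᵀ) (fun _ _ => measurable_const)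
    (measurable_mulVec_apply (v := fun _ => t.ofLp) (measurable_invSqrt_plugIn_apply A)
      fun _ => measurable_const) i

theorem measurable_twoStep {n d : ℕ} :
    Measurable fun z : (Fin n → EuclideanSpace ℝ (Fin d)) × (Fin n → ℝ) × (Fin n → ℝ) =>
      twoStep z.1 z.2.1 z.2.2 := by
  have hI : ∀ i : Fin n, MeasurableSet {z : (Fin n → EuclideanSpace ℝ (Fin d)) × (Fin n → ℝ) ×
      (Fin n → ℝ) | i ∈ Finset.univ.filter fun i => z.2.2 i = 0} := fun i => by
    simp only [Finset.mem_filter, Finset.mem_univ, true_and]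
    have : Measurable fun z : (Fin n → EuclideanSpace ℝ (Fin d)) × (Fin n → ℝ) × (Fin n → ℝ) =>
      z.2.2 i := by fun_prop
    exact this (measurableSet_singleton 0)
  refine measurable_toLp_mulVec (measurable_nonsing_inv_apply
    (measurable_gramOn_apply measurable_fst hI)) fun j => ?_
  simp only [Finset.sum_filter]
  refine Finset.measurable_sum _ fun i _ => Measurable.ite ?_ ?_ measurable_const
  · simpa using hI i
  · fun_prop

theorem measurable_studentize {n d q : ℕ} (A : Matrix (Fin q) (Fin d) ℝ)
    (b : EuclideanSpace ℝ (Fin d)) :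
    Measurable fun z : (Fin n → EuclideanSpace ℝ (Fin d)) × EuclideanSpace ℝ (Fin d) =>
      (WithLp.toLp 2 (√(n : ℝ) • (invSqrt (plugIn A z.1) *ᵥ
        (A *ᵥ WithLp.ofLp (z.2 - b)))) : EuclideanSpace ℝ (Fin q)) := by
  simp only [← Matrix.smul_mulVec]
  refine measurable_toLp_mulVec (fun i j => ?_) fun i => ?_
  · simp only [Matrix.smul_apply, smul_eq_mul]
    exact ((measurable_invSqrt_plugIn_apply A i j).comp measurable_fst).const_mul _
  · refine measurable_mulVec_apply (B := fun _ => A) (fun _ _ => measurable_const)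
      (fun k => ?_) i
    fun_prop

theorem IncidentalModel.aemeasurable_studentized {Ω : ℕ → Type*} [∀ n, MeasurableSpace (Ω n)]
    (M : IncidentalModel Ω) {q : ℕ} (A : ∀ n, Matrix (Fin q) (Fin (M.d n)) ℝ) (n : ℕ)
    {P : Measure (Ω n)} (hX : AEMeasurable (M.sampleX n) P)
    {b : Ω n → EuclideanSpace ℝ (Fin (M.d n))} (hb : AEMeasurable b P) :
    AEMeasurable (M.studentized A n b) P := by
  have h := (measurable_studentize (n := n) (A n) (M.βStar n)).comp_aemeasurable (hX.prodMk hb)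
  have e : M.studentized A n b = (fun z : (Fin n → EuclideanSpace ℝ (Fin (M.d n))) ×
      EuclideanSpace ℝ (Fin (M.d n)) =>
      (WithLp.toLp 2 (√(n : ℝ) • (invSqrt (plugIn (A n) z.1) *ᵥ
        (A n *ᵥ WithLp.ofLp (z.2 - M.βStar n)))) : EuclideanSpace ℝ (Fin q)))
        ∘ (fun ω => (M.sampleX n ω, b ω)) := by
    ext1 ω
    simp only [IncidentalModel.studentized, IncidentalModel.GXhat, plugIn, Function.comp_apply]
  rw [e]
  exact h

/-! ### Moment and Chebyshev bounds. -/

section moments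

variable {Ω : Type*} [MeasurableSpace Ω] {P : Measure Ω}

/-- Chebyshev's inequality for vector-valued sums with orthogonal summands. The index type `J` is
the set of coordinates for scores, and of pairs of coordinates for Gram matrices. -/
theorem measure_sum_sq_ge_le [IsProbabilityMeasure P] {ι J : Type*} [Fintype J] (s : Finset ι)
    {Z : ι → J → Ω → ℝ} {K t : ℝ} (hL : ∀ i ∈ s, ∀ j, MemLp (Z i j) 2 P)
    (horth : ∀ i ∈ s, ∀ i' ∈ s, i ≠ i' → ∀ j, ∫ ω, Z i j ω * Z i' j ω ∂P = 0)
    (hK : ∀ i ∈ s, ∑ j, ∫ ω, Z i j ω ^ 2 ∂P ≤ K) (ht : 0 < t) :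
    P {ω | t ≤ ∑ j, (∑ i ∈ s, Z i j ω) ^ 2} ≤ ENNReal.ofReal (s.card * K / t) := by
  classical
  have hint : ∀ i ∈ s, ∀ i' ∈ s, ∀ j, Integrable (fun ω => Z i j ω * Z i' j ω) P :=
    fun i hi i' hi' j => (hL i hi j).integrable_mul (hL i' hi' j)
  have hexp : ∀ ω, ∑ j, (∑ i ∈ s, Z i j ω) ^ 2 = ∑ j, ∑ i ∈ s, ∑ i' ∈ s, Z i j ω * Z i' j ω :=
    fun ω => Finset.sum_congr rfl fun j _ => by rw [sq, Finset.sum_mul_sum]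
  have hI : Integrable (fun ω => ∑ j, (∑ i ∈ s, Z i j ω) ^ 2) P := by
    simp_rw [hexp]
    exact integrable_finsetSum _ fun j _ => integrable_finsetSum _ fun i hi =>
      integrable_finsetSum _ fun i' hi' => hint i hi i' hi' j
  have hE : ∫ ω, ∑ j, (∑ i ∈ s, Z i j ω) ^ 2 ∂P ≤ s.card * K := by
    simp_rw [hexp]
    rw [integral_finsetSum _ fun j _ => integrable_finsetSum _ fun i hi =>
      integrable_finsetSum _ fun i' hi' => hint i hi i' hi' j]
    have h1 : ∀ j, ∫ ω, ∑ i ∈ s, ∑ i' ∈ s, Z i j ω * Z i' j ω ∂P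
        = ∑ i ∈ s, ∫ ω, Z i j ω ^ 2 ∂P := by
      intro j
      rw [integral_finsetSum _ fun i hi => integrable_finsetSum _ fun i' hi' => hint i hi i' hi' j]
      refine Finset.sum_congr rfl fun i hi => ?_
      rw [integral_finsetSum _ fun i' hi' => hint i hi i' hi' j,
        Finset.sum_eq_single_of_mem i hi fun i' hi' hne => horth i hi i' hi' hne.symm j]
      simp_rw [sq]
    simp_rw [h1]
    rw [Finset.sum_comm]
    calc _ ≤ ∑ i ∈ s, K := Finset.sum_le_sum hK
      _ = _ := by simp
  have hM := mul_meas_ge_le_integral_of_nonneg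
    (Eventually.of_forall fun ω => Finset.sum_nonneg fun j _ => sq_nonneg (∑ i ∈ s, Z i j ω)) hI t
  rw [← ofReal_measureReal (measure_ne_top _ _)]
  refine ENNReal.ofReal_le_ofReal ?_
  rw [le_div_iff₀ ht]
  linarith

theorem MemLp.mul_of_four {f g : Ω → ℝ} (hf : MemLp f 4 P) (hg : MemLp g 4 P) :
    MemLp (fun ω => f ω * g ω) 2 P := by
  have : ENNReal.HolderTriple 4 4 2 := ⟨by
    rw [← ENNReal.toReal_eq_toReal_iff' (by simp) (by simp), ENNReal.toReal_add (by simp) (by simp)]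
    norm_num⟩
  exact MemLp.mul' hg hf

/-- Cauchy–Schwarz in product form, so that double sums over coordinates factor into `fourthSum ν ^
2`. -/
theorem integral_sq_mul_sq_le {f g : Ω → ℝ} (hf : MemLp f 4 P) (hg : MemLp g 4 P) :
    ∫ ω, (f ω * g ω) ^ 2 ∂P ≤ √(∫ ω, f ω ^ 4 ∂P) * √(∫ ω, g ω ^ 4 ∂P) := by
  have h2 : ENNReal.ofReal 2 = 2 := by norm_num
  have h := integral_mul_le_Lp_mul_Lq_of_nonneg (μ := P) (p := 2) (q := 2)
    (f := fun ω => f ω * f ω) (g := fun ω => g ω * g ω) Real.HolderConjugate.two_two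
    (Eventually.of_forall fun ω => mul_self_nonneg _)
    (Eventually.of_forall fun ω => mul_self_nonneg _)
    (by rw [h2]; exact MemLp.mul_of_four hf hf) (by rw [h2]; exact MemLp.mul_of_four hg hg)
  rw [← Real.sqrt_eq_rpow, ← Real.sqrt_eq_rpow] at h
  have e1 : ∀ r : ℝ, (r * r) ^ (2 : ℝ) = r ^ 4 := fun r => by
    rw [Real.rpow_two]; ring
  have e2 : ∀ ω, f ω * f ω * (g ω * g ω) = (f ω * g ω) ^ 2 := fun ω => by ring
  simpa only [e1, e2] using h

theorem integral_sq_le_sqrt [IsProbabilityMeasure P] {f : Ω → ℝ} (hf : MemLp f 4 P) :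
    ∫ ω, f ω ^ 2 ∂P ≤ √(∫ ω, f ω ^ 4 ∂P) := by
  have h := integral_sq_mul_sq_le hf (memLp_const (1 : ℝ) (μ := P))
  simpa using h

variable {n d : ℕ} {X : Fin n → Ω → EuclideanSpace ℝ (Fin d)}
  {ν : Measure (EuclideanSpace ℝ (Fin d))}

/-- `∑_j (E x_j⁴)^{1/2}`. -/
def fourthSum {d : ℕ} (ν : Measure (EuclideanSpace ℝ (Fin d))) : ℝ :=
  ∑ j, √(∫ x, x j ^ 4 ∂ν)

theorem memLp_comp_of_hasLaw {Y : Ω → EuclideanSpace ℝ (Fin d)} (hY : HasLaw Y ν P)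
    {p : ℝ≥0∞} {f : EuclideanSpace ℝ (Fin d) → ℝ} (h : MemLp f p ν) :
    MemLp (fun ω => f (Y ω)) p P := by
  have h' : MemLp f p (P.map Y) := by rwa [hY.map_eq]
  exact h'.comp_of_map hY.aemeasurable

theorem integral_comp_of_hasLaw {Y : Ω → EuclideanSpace ℝ (Fin d)} (hY : HasLaw Y ν P)
    {f : EuclideanSpace ℝ (Fin d) → ℝ} (h : AEStronglyMeasurable f ν) :
    ∫ ω, f (Y ω) ∂P = ∫ x, f x ∂ν :=
  hY.integral_comp h

theorem integral_apply_mul_apply_eq_zero (hX : ∀ i, HasLaw (X i) ν P) (hind : iIndepFun X P)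
    (h0 : ∀ j, ∫ x, x j ∂ν = 0) {i i' : Fin n} (hne : i ≠ i') (j : Fin d) :
    ∫ ω, X i ω j * X i' ω j ∂P = 0 := by
  have hm : Measurable fun x : EuclideanSpace ℝ (Fin d) => x j := by fun_prop
  have ha : ∀ i, AEStronglyMeasurable (fun ω => X i ω j) P := fun i =>
    (hm.comp_aemeasurable (hX i).aemeasurable).aestronglyMeasurable
  have h := ((hind.indepFun hne).comp hm hm).integral_fun_mul_eq_mul_integral (ha i) (ha i')
  simp only [Function.comp_apply] at h
  rw [h, integral_comp_of_hasLaw (hX i) (f := fun x => x j) (by fun_prop), h0, zero_mul]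

variable [IsProbabilityMeasure P]

/-- Markov's inequality for `∑ i, ‖X i‖⁴`, with `E‖X i‖⁴ ≤ fourthSum ν ^ 2`. -/
theorem measure_exists_lt_norm_le (hX : ∀ i, HasLaw (X i) ν P)
    (h4 : ∀ j, MemLp (fun x : EuclideanSpace ℝ (Fin d) => x j) 4 ν) {t : ℝ} (ht : 0 < t) :
    P {ω | ∃ i, t < ‖X i ω‖} ≤ ENNReal.ofReal (n * fourthSum ν ^ 2 / t ^ 4) := by
  have hL : ∀ i j, MemLp (fun ω => X i ω j) 4 P := fun i j => memLp_comp_of_hasLaw (hX i) (h4 j)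
  have hint : ∀ i j k, Integrable (fun ω => (X i ω j * X i ω k) ^ 2) P := fun i j k =>
    (MemLp.mul_of_four (hL i j) (hL i k)).integrable_sq
  have hexp : ∀ i ω, ‖X i ω‖ ^ 4 = ∑ j, ∑ k, (X i ω j * X i ω k) ^ 2 := fun i ω => by
    rw [show ‖X i ω‖ ^ 4 = ‖X i ω‖ ^ 2 * ‖X i ω‖ ^ 2 by ring, EuclideanSpace.real_norm_sq_eq,
      Finset.sum_mul_sum]
    simp only [mul_pow]
  have hi4 : ∀ i, Integrable (fun ω => ‖X i ω‖ ^ 4) P := fun i => by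
    simp_rw [hexp]
    exact integrable_finsetSum _ fun j _ => integrable_finsetSum _ fun k _ => hint i j k
  have hE : ∀ i, ∫ ω, ‖X i ω‖ ^ 4 ∂P ≤ fourthSum ν ^ 2 := fun i => by
    simp_rw [hexp]
    rw [integral_finsetSum _ fun j _ => integrable_finsetSum _ fun k _ => hint i j k, sq,
      fourthSum, Finset.sum_mul_sum]
    refine Finset.sum_le_sum fun j _ => ?_
    rw [integral_finsetSum _ fun k _ => hint i j k]
    refine Finset.sum_le_sum fun k _ => ?_
    have h := integral_sq_mul_sq_le (hL i j) (hL i k)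
    rwa [integral_comp_of_hasLaw (hX i) (f := fun x => x j ^ 4) (by fun_prop),
      integral_comp_of_hasLaw (hX i) (f := fun x => x k ^ 4) (by fun_prop)] at h
  have hsub : {ω | ∃ i, t < ‖X i ω‖} ⊆ {ω | t ^ 4 ≤ ∑ i, ‖X i ω‖ ^ 4} := by
    rintro ω ⟨i, hi⟩
    calc t ^ 4 ≤ ‖X i ω‖ ^ 4 := by gcongr
      _ ≤ _ := Finset.single_le_sum (f := fun i => ‖X i ω‖ ^ 4) (fun _ _ => by positivity)
        (Finset.mem_univ i)
  refine (measure_mono hsub).trans ?_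
  have hM := mul_meas_ge_le_integral_of_nonneg (μ := P) (f := fun ω => ∑ i, ‖X i ω‖ ^ 4)
    (Eventually.of_forall fun ω => Finset.sum_nonneg fun j _ => by positivity)
    (integrable_finsetSum _ fun i _ => hi4 i) (t ^ 4)
  rw [integral_finsetSum _ fun i _ => hi4 i] at hM
  rw [← ofReal_measureReal (measure_ne_top _ _)]
  refine ENNReal.ofReal_le_ofReal ?_
  rw [le_div_iff₀ (by positivity)]
  calc _ ≤ _ := by rw [mul_comm]; exact hM
    _ ≤ ∑ _i : Fin n, fourthSum ν ^ 2 := Finset.sum_le_sum fun i _ => hE i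
    _ = _ := by simp

theorem sum_integral_sq_le [IsProbabilityMeasure ν]
    (h4 : ∀ j, MemLp (fun x : EuclideanSpace ℝ (Fin d) => x j) 4 ν) :
    ∑ j, ∫ x, x j ^ 2 ∂ν ≤ fourthSum ν :=
  Finset.sum_le_sum fun j _ => integral_sq_le_sqrt (h4 j)

/-- Deviation of a Gram matrix from its expectation. -/
theorem measure_gram_deviation_le [IsProbabilityMeasure ν] (hX : ∀ i, HasLaw (X i) ν P)
    (hind : iIndepFun X P) (h4 : ∀ j, MemLp (fun x : EuclideanSpace ℝ (Fin d) => x j) 4 ν)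
    (I : Finset (Fin n)) {t : ℝ} (ht : 0 < t) :
    P {ω | t ≤ ∑ p : Fin d × Fin d, (∑ i ∈ I,
      (X i ω p.1 * X i ω p.2 - ∫ x, x p.1 * x p.2 ∂ν)) ^ 2}
      ≤ ENNReal.ofReal (I.card * fourthSum ν ^ 2 / t) := by
  have hp : ∀ j k, MemLp (fun x : EuclideanSpace ℝ (Fin d) => x j * x k) 2 ν := fun j k =>
    MemLp.mul_of_four (h4 j) (h4 k)
  have hpc : ∀ j k, MemLp (fun x : EuclideanSpace ℝ (Fin d) =>
      x j * x k - ∫ x, x j * x k ∂ν) 2 ν := fun j k => (hp j k).sub (memLp_const _)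
  have hz : ∀ i j k, ∫ ω, (X i ω j * X i ω k - ∫ x, x j * x k ∂ν) ∂P = 0 := fun i j k => by
    rw [integral_comp_of_hasLaw (hX i) (f := fun x => x j * x k - ∫ x, x j * x k ∂ν) (by fun_prop),
      integral_sub ((hp j k).integrable (by norm_num)) (integrable_const _)]
    simp
  have hL : ∀ i (p : Fin d × Fin d), MemLp (fun ω => X i ω p.1 * X i ω p.2
      - ∫ x, x p.1 * x p.2 ∂ν) 2 P := fun i p =>
    memLp_comp_of_hasLaw (hX i) (f := fun x => x p.1 * x p.2 - ∫ x, x p.1 * x p.2 ∂ν)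
      (hpc p.1 p.2)
  have horth : ∀ i i', i ≠ i' → ∀ p : Fin d × Fin d,
      ∫ ω, (X i ω p.1 * X i ω p.2 - ∫ x, x p.1 * x p.2 ∂ν)
        * (X i' ω p.1 * X i' ω p.2 - ∫ x, x p.1 * x p.2 ∂ν) ∂P = 0 := by
    intro i i' hne p
    have hm : Measurable fun x : EuclideanSpace ℝ (Fin d) => x p.1 * x p.2
      - ∫ x, x p.1 * x p.2 ∂ν := by fun_prop
    have h := ((hind.indepFun hne).comp hm hm).integral_fun_mul_eq_mul_integral
      (hL i p).aestronglyMeasurable (hL i' p).aestronglyMeasurable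
    simp only [Function.comp_apply, hz, mul_zero] at h
    exact h
  have hsq : ∀ i j k, ∫ ω, (X i ω j * X i ω k - ∫ x, x j * x k ∂ν) ^ 2 ∂P
      ≤ √(∫ x, x j ^ 4 ∂ν) * √(∫ x, x k ^ 4 ∂ν) := by
    intro i j k
    rw [integral_comp_of_hasLaw (hX i) (f := fun x => (x j * x k - ∫ x, x j * x k ∂ν) ^ 2)
      (by fun_prop)]
    refine le_trans ?_ (integral_sq_mul_sq_le (h4 j) (h4 k))
    have hv := variance_le_expectation_sq (μ := ν)
      (X := fun x : EuclideanSpace ℝ (Fin d) => x j * x k) (hp j k).aestronglyMeasurable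
    rwa [variance_eq_integral (hp j k).aestronglyMeasurable.aemeasurable] at hv
  refine measure_sum_sq_ge_le I (fun i _ p => hL i p) (fun i _ i' _ => horth i i')
    (fun i _ => ?_) ht
  rw [Fintype.sum_prod_type, sq, fourthSum, Finset.sum_mul_sum]
  exact Finset.sum_le_sum fun j _ => Finset.sum_le_sum fun k _ => hsq i j k

theorem measure_norm_sum_smul_le [IsProbabilityMeasure ν] (hX : ∀ i, HasLaw (X i) ν P)
    (hind : iIndepFun X P) (h4 : ∀ j, MemLp (fun x : EuclideanSpace ℝ (Fin d) => x j) 4 ν)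
    (h0 : ∀ j, ∫ x, x j ∂ν = 0) (I : Finset (Fin n)) (a : Fin n → ℝ) (ha : ∀ i, |a i| ≤ 1)
    {t : ℝ} (ht : 0 < t) :
    P {ω | t ≤ ‖∑ i ∈ I, a i • X i ω‖} ≤ ENNReal.ofReal (I.card * fourthSum ν / t ^ 2) := by
  have hL : ∀ i j, MemLp (fun ω => X i ω j) 2 P := fun i j =>
    (memLp_comp_of_hasLaw (hX i) (h4 j)).mono_exponent (by norm_num)
  have h := measure_sum_sq_ge_le (P := P) I (Z := fun i j ω => a i * X i ω j) (K := fourthSum ν)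
    (t := t ^ 2) (fun i _ j => (hL i j).const_mul (a i)) ?_ ?_ (by positivity)
  · refine (measure_mono fun ω hω => ?_).trans h
    simp only [Set.mem_ofPred_eq] at hω ⊢
    have h1 : t ^ 2 ≤ ‖∑ i ∈ I, a i • X i ω‖ ^ 2 := by gcongr
    rw [EuclideanSpace.real_norm_sq_eq] at h1
    simpa using h1
  · intro i _ i' _ hne j
    have : (fun ω => a i * X i ω j * (a i' * X i' ω j))
      = fun ω => (a i * a i') * (X i ω j * X i' ω j) := by ext; ring
    rw [this, integral_const_mul, integral_apply_mul_apply_eq_zero hX hind h0 hne, mul_zero]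
  · intro i _
    refine le_trans (Finset.sum_le_sum fun j _ => ?_) (sum_integral_sq_le h4)
    simp_rw [mul_pow]
    rw [integral_const_mul, integral_comp_of_hasLaw (hX i) (f := fun x => x j ^ 2) (by fun_prop)]
    have h1 : a i ^ 2 ≤ 1 := by rw [sq_le_one_iff_abs_le_one]; exact ha i
    have h2 : 0 ≤ ∫ x, x j ^ 2 ∂ν := integral_nonneg fun _ => sq_nonneg _
    nlinarith

/-- The cross terms vanish through the covariates: `X_i X_i'` is centred for `i ≠ i'` and
independent of `ε_i ε_i'`. -/
theorem measure_norm_sum_noise_le [IsProbabilityMeasure ν] {μ : Measure ℝ} {σ : ℝ}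
    {ε : Fin n → Ω → ℝ} (hX : ∀ i, HasLaw (X i) ν P)
    (hind : iIndepFun X P) (h4 : ∀ j, MemLp (fun x : EuclideanSpace ℝ (Fin d) => x j) 4 ν)
    (h0 : ∀ j, ∫ x, x j ∂ν = 0) (hε : ∀ i, HasLaw (ε i) μ P)
    (hXε : IndepFun (fun ω i => X i ω) (fun ω i => ε i ω) P)
    (h2 : MemLp id 2 μ) (hvar : ∫ e, e ^ 2 ∂μ = σ ^ 2)
    (I : Finset (Fin n)) {t : ℝ} (ht : 0 < t) :
    P {ω | t ≤ ‖∑ i ∈ I, ε i ω • X i ω‖}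
      ≤ ENNReal.ofReal (I.card * (σ ^ 2 * fourthSum ν) / t ^ 2) := by
  have hL : ∀ i j, MemLp (fun ω => X i ω j) 2 P := fun i j =>
    (memLp_comp_of_hasLaw (hX i) (h4 j)).mono_exponent (by norm_num)
  have hLε : ∀ i, MemLp (ε i) 2 P := fun i => by
    have h' : MemLp id 2 (P.map (ε i)) := by rwa [(hε i).map_eq]
    exact h'.comp_of_map (hε i).aemeasurable
  have hindc : ∀ (f : (Fin n → EuclideanSpace ℝ (Fin d)) → ℝ) (g : (Fin n → ℝ) → ℝ),
      Measurable f → Measurable g →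
      IndepFun (fun ω => f fun i => X i ω) (fun ω => g fun i => ε i ω) P :=
    fun f g hf hg => hXε.comp hf hg
  have hXi : ∀ (i : Fin n) (j : Fin d), Measurable fun x : Fin n → EuclideanSpace ℝ (Fin d) =>
    x i j := fun i j => by fun_prop
  have h := measure_sum_sq_ge_le (P := P) I (Z := fun i j ω => ε i ω * X i ω j)
    (K := σ ^ 2 * fourthSum ν) (t := t ^ 2) (fun i _ j => ?_) ?_ ?_ (by positivity)
  · refine (measure_mono fun ω hω => ?_).trans h
    simp only [Set.mem_ofPred_eq] at hω ⊢
    have h1 : t ^ 2 ≤ ‖∑ i ∈ I, ε i ω • X i ω‖ ^ 2 := by gcongr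
    rw [EuclideanSpace.real_norm_sq_eq] at h1
    simpa using h1
  · refine (memLp_two_iff_integrable_sq ((hLε i).aestronglyMeasurable.mul
      (hL i j).aestronglyMeasurable)).2 ?_
    have hi := (hindc (fun x => x i j ^ 2) (fun e => e i ^ 2) ((hXi i j).pow_const 2)
      (by fun_prop)).symm.integrable_mul (hLε i).integrable_sq (hL i j).integrable_sq
    refine hi.congr (Eventually.of_forall fun ω => ?_)
    simp [mul_pow]
  · intro i _ i' _ hne j
    have : (fun ω => ε i ω * X i ω j * (ε i' ω * X i' ω j))
      = fun ω => (X i ω j * X i' ω j) * (ε i ω * ε i' ω) := by ext; ring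
    rw [this, (hindc (fun x => x i j * x i' j) (fun e => e i * e i') ((hXi i j).mul (hXi i' j))
      (by fun_prop)).integral_fun_mul_eq_mul_integral
      ((hL i j).aestronglyMeasurable.mul (hL i' j).aestronglyMeasurable)
      ((hLε i).aestronglyMeasurable.mul (hLε i').aestronglyMeasurable),
      integral_apply_mul_apply_eq_zero hX hind h0 hne, zero_mul]
  · intro i _
    have h1 : ∀ j, ∫ ω, (ε i ω * X i ω j) ^ 2 ∂P = σ ^ 2 * ∫ x, x j ^ 2 ∂ν := by
      intro j
      have e1 : ∫ ω, ε i ω ^ 2 ∂P = σ ^ 2 := by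
        rw [← hvar]
        exact (hε i).integral_comp (f := fun e : ℝ => e ^ 2) (by fun_prop)
      simp_rw [mul_pow]
      rw [(hindc (fun x => x i j ^ 2) (fun e => e i ^ 2) ((hXi i j).pow_const 2)
        (by fun_prop)).symm.integral_fun_mul_eq_mul_integral
        ((hLε i).aestronglyMeasurable.pow 2) ((hL i j).aestronglyMeasurable.pow 2), e1,
        integral_comp_of_hasLaw (hX i) (f := fun x => x j ^ 2) (by fun_prop)]
    simp_rw [h1]
    rw [← Finset.mul_sum]
    exact mul_le_mul_of_nonneg_left (sum_integral_sq_le h4) (sq_nonneg σ)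

end moments

/-! ### Concentration of the Gram quadratic form. -/

theorem abs_sum_quadratic_le {d : ℕ} (D : Fin d × Fin d → ℝ) (v : EuclideanSpace ℝ (Fin d)) :
    |∑ p : Fin d × Fin d, D p * (v p.1 * v p.2)| ≤ √(∑ p, D p ^ 2) * ‖v‖ ^ 2 := by
  have h := Finset.sum_mul_sq_le_sq_mul_sq Finset.univ D fun p => v p.1 * v p.2
  have h1 : ∑ p : Fin d × Fin d, (v p.1 * v p.2) ^ 2 = (‖v‖ ^ 2) ^ 2 := by
    rw [Fintype.sum_prod_type, EuclideanSpace.real_norm_sq_eq, sq (∑ i, v.ofLp i ^ 2),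
      Finset.sum_mul_sum]
    simp only [mul_pow]
  rw [h1] at h
  refine Real.abs_le_sqrt h |>.trans ?_
  rw [Real.sqrt_mul (Finset.sum_nonneg fun _ _ => sq_nonneg _), Real.sqrt_sq (sq_nonneg _)]

theorem sum_inner_sq_sub {n d : ℕ} (x : Fin n → EuclideanSpace ℝ (Fin d)) (I : Finset (Fin n))
    (S : Matrix (Fin d) (Fin d) ℝ) (v : EuclideanSpace ℝ (Fin d)) :
    ∑ i ∈ I, inner ℝ (x i) v ^ 2 - I.card * (v.ofLp ⬝ᵥ (S *ᵥ v.ofLp))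
      = ∑ p : Fin d × Fin d, (∑ i ∈ I, (x i p.1 * x i p.2 - S p.1 p.2)) * (v p.1 * v p.2) := by
  have h1 : ∑ i ∈ I, inner ℝ (x i) v ^ 2 = v.ofLp ⬝ᵥ (gramOn x I *ᵥ v.ofLp) := by
    rw [dotProduct_gramOn_mulVec]; simp only [sq]
  rw [h1, Fintype.sum_prod_type]
  simp only [dotProduct, Matrix.mulVec, gramOn, Matrix.of_apply, Finset.mul_sum,
    ← Finset.sum_sub_distrib]
  refine Finset.sum_congr rfl fun j _ => Finset.sum_congr rfl fun k _ => ?_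
  rw [Finset.sum_sub_distrib]
  simp
  ring

/-- Eigenvalues of `S - c • 1` are those of `S` shifted by `-c`, so this difference is positive
semidefinite. -/
theorem le_dotProduct_of_eigenvalues {d : ℕ} {S : Matrix (Fin d) (Fin d) ℝ} (hS : Sᵀ = S) {c : ℝ}
    (h : ∀ t : ℝ, Module.End.HasEigenvalue (Matrix.toLin' S) t → c ≤ t)
    (v : EuclideanSpace ℝ (Fin d)) : c * ‖v‖ ^ 2 ≤ v.ofLp ⬝ᵥ (S *ᵥ v.ofLp) := by
  have hH : (S - c • (1 : Matrix (Fin d) (Fin d) ℝ)).IsHermitian := by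
    rw [Matrix.IsHermitian, Matrix.conjTranspose_eq_transpose_of_trivial]
    simp [hS]
  have hpsd : (S - c • (1 : Matrix (Fin d) (Fin d) ℝ)).PosSemidef := by
    rw [hH.posSemidef_iff_eigenvalues_nonneg]
    intro i
    have hv := hH.mulVec_eigenvectorBasis i
    have hne : (hH.eigenvectorBasis i).ofLp ≠ 0 := by
      intro h0
      have h1 := hH.eigenvectorBasis.orthonormal.1 i
      rw [show hH.eigenvectorBasis i = 0 from by ext k; simp [h0]] at h1
      simp at h1
    have he : Module.End.HasEigenvalue (Matrix.toLin' S) (c + hH.eigenvalues i) := by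
      refine Module.End.hasEigenvalue_of_hasEigenvector (x := (hH.eigenvectorBasis i).ofLp)
        ⟨Module.End.mem_eigenspace_iff.2 ?_, hne⟩
      rw [Matrix.sub_mulVec, sub_eq_iff_eq_add] at hv
      rw [Matrix.toLin'_apply, hv, Matrix.smul_mulVec, Matrix.one_mulVec, add_smul, add_comm]
    have := h _ he
    simpa using this
  have h2 := hpsd.dotProduct_mulVec_nonneg v.ofLp
  rw [star_trivial, Matrix.sub_mulVec, dotProduct_sub, Matrix.smul_mulVec, Matrix.one_mulVec,
    dotProduct_smul, smul_eq_mul] at h2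
  have h3 : ‖v‖ ^ 2 = v.ofLp ⬝ᵥ v.ofLp := by
    rw [← inner_eq_ofLp_dotProduct, real_inner_self_eq_norm_sq]
  rw [h3]
  linarith

/-- Frobenius deviations bound those of the quadratic forms, and `hS` turns `c‖v‖²` into a multiple
of the population form. The few removed observations therefore carry only a small fraction of the
full form. -/
theorem gram_compare {n d s : ℕ} {x : Fin n → EuclideanSpace ℝ (Fin d)} {I : Finset (Fin n)}
    {S : Matrix (Fin d) (Fin d) ℝ} {c η : ℝ} (hc : 0 < c) (hη : 0 < η) (hη1 : η ≤ 1 / 2)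
    (hS : ∀ v : EuclideanSpace ℝ (Fin d), c * ‖v‖ ^ 2 ≤ v.ofLp ⬝ᵥ (S *ᵥ v.ofLp))
    (hI : Iᶜ.card ≤ s) (hs : (s : ℝ) ≤ η / 4 * n)
    (hU : √(∑ p : Fin d × Fin d, (∑ i, (x i p.1 * x i p.2 - S p.1 p.2)) ^ 2) ≤ η * c / 4 * n)
    (hJ : √(∑ p : Fin d × Fin d, (∑ i ∈ Iᶜ, (x i p.1 * x i p.2 - S p.1 p.2)) ^ 2)
      ≤ η * c / 4 * n) :
    (∀ v, c / 4 * n * ‖v‖ ^ 2 ≤ ∑ i ∈ I, inner ℝ (x i) v ^ 2) ∧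
    ∀ v, (1 - η) * ∑ i, inner ℝ (x i) v ^ 2 ≤ ∑ i ∈ I, inner ℝ (x i) v ^ 2 := by
  have key : ∀ v : EuclideanSpace ℝ (Fin d), c / 4 * n * ‖v‖ ^ 2 ≤ ∑ i ∈ I, inner ℝ (x i) v ^ 2 ∧
      (1 - η) * ∑ i, inner ℝ (x i) v ^ 2 ≤ ∑ i ∈ I, inner ℝ (x i) v ^ 2 := by
    intro v
    have hsum := Finset.sum_add_sum_compl I fun i => inner ℝ (x i) v ^ 2
    have h1 := (abs_sum_quadratic_le (fun p => ∑ i, (x i p.1 * x i p.2 - S p.1 p.2)) v).trans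
      (mul_le_mul_of_nonneg_right hU (sq_nonneg ‖v‖))
    have h2 := (abs_sum_quadratic_le (fun p => ∑ i ∈ Iᶜ, (x i p.1 * x i p.2 - S p.1 p.2)) v).trans
      (mul_le_mul_of_nonneg_right hJ (sq_nonneg ‖v‖))
    rw [← sum_inner_sq_sub] at h1 h2
    simp only [Finset.card_univ, Fintype.card_fin] at h1
    have hQ := hS v
    set Q := v.ofLp ⬝ᵥ (S *ᵥ v.ofLp)
    have hQ0 : 0 ≤ Q := le_trans (by positivity) hQ
    have hn : (0 : ℝ) ≤ n := Nat.cast_nonneg n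
    have hcard : ((Iᶜ.card : ℕ) : ℝ) * Q ≤ η / 4 * n * Q := by
      gcongr
      exact le_trans (by exact_mod_cast hI) hs
    have hnQ : c * ‖v‖ ^ 2 * n ≤ Q * n := mul_le_mul_of_nonneg_right hQ hn
    have hηnQ : η * (c * ‖v‖ ^ 2 * n) ≤ η * (Q * n) := mul_le_mul_of_nonneg_left hnQ hη.le
    have h3 := (abs_le.1 h1).1
    have h4 := (abs_le.1 h2).2
    have hQn : 0 ≤ Q * n := mul_nonneg hQ0 hn
    -- The full form loses at most `η / 4 ≤ 1 / 8` of `nQ`. The removed part has expectation and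
    -- deviation at most `η / 4` of `nQ` each.
    have hU' : (7 / 8) * (Q * n) ≤ ∑ i, inner ℝ (x i) v ^ 2 := by nlinarith
    have hJ' : ∑ i ∈ Iᶜ, inner ℝ (x i) v ^ 2 ≤ η / 2 * (Q * n) := by nlinarith
    have hηQ : 0 ≤ η * (Q * n) := by positivity
    constructor
    · nlinarith
    · nlinarith
  exact ⟨fun v => (key v).1, fun v => (key v).2⟩

/-! ### Least squares on the observations without large incidental parameters. -/

theorem norm_gramSolve_le {n d : ℕ} {x : Fin n → EuclideanSpace ℝ (Fin d)} {I : Finset (Fin n)}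
    {c : ℝ} (hc : 0 < c) (hlow : ∀ v, c * ‖v‖ ^ 2 ≤ ∑ i ∈ I, inner ℝ (x i) v ^ 2)
    (a : EuclideanSpace ℝ (Fin d)) : ‖gramSolve x I a‖ ≤ ‖a‖ / c := by
  have hI := gramOn_posDef x I hc hlow
  have h1 := hlow (gramSolve x I a)
  have h2 := gramSolve_spec hI a (gramSolve x I a)
  simp only [← sq] at h2
  rw [h2] at h1
  have h3 := h1.trans (real_inner_le_norm a (gramSolve x I a))
  rw [le_div_iff₀ hc]
  by_contra hlt
  push Not at hlt
  have h4 : 0 < ‖gramSolve x I a‖ := by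
    by_contra h0
    have : ‖gramSolve x I a‖ = 0 := le_antisymm (not_lt.1 h0) (norm_nonneg _)
    rw [this, zero_mul] at hlt
    exact absurd hlt (not_lt.2 (norm_nonneg a))
  nlinarith

theorem gramSolve_add {n d : ℕ} (x : Fin n → EuclideanSpace ℝ (Fin d)) (I : Finset (Fin n))
    (a b : EuclideanSpace ℝ (Fin d)) :
    gramSolve x I (a + b) = gramSolve x I a + gramSolve x I b := by
  simp [gramSolve, Matrix.mulVec_add]

/-- The observations without a large incidental parameter. -/
def tailIdx (n s : ℕ) : Finset (Fin n) := Finset.univ.filter fun i => s ≤ (i : ℕ)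

theorem mem_tailIdx {n s : ℕ} {i : Fin n} : i ∈ tailIdx n s ↔ s ≤ (i : ℕ) := by
  simp [tailIdx]

theorem card_filter_Ico_le (n a b : ℕ) :
    (Finset.univ.filter fun i : Fin n => a ≤ (i : ℕ) ∧ (i : ℕ) < a + b).card ≤ b := by
  have h := Finset.card_le_card_of_injOn (s := Finset.univ.filter fun i : Fin n =>
    a ≤ (i : ℕ) ∧ (i : ℕ) < a + b) (t := Finset.Ico a (a + b)) (fun i => (i : ℕ))
    (fun i hi => by simpa using hi) (fun i _ j _ h => Fin.ext h)
  simpa using h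

theorem card_compl_tailIdx_le (n s : ℕ) : (tailIdx n s)ᶜ.card ≤ s := by
  have h : (tailIdx n s)ᶜ = Finset.univ.filter fun i : Fin n => 0 ≤ (i : ℕ) ∧ (i : ℕ) < 0 + s := by
    ext i
    simp [tailIdx]
  rw [h]
  exact card_filter_Ico_le n 0 s

theorem norm_sum_smul_tailIdx_le {n d s₁ s₂ : ℕ} {x : Fin n → EuclideanSpace ℝ (Fin d)}
    {μ : Fin n → ℝ} {κ γ : ℝ} (hκ : 0 ≤ κ) (hx : ∀ i, ‖x i‖ ≤ κ)
    (hγ : ∀ i : Fin n, s₁ ≤ (i : ℕ) → (i : ℕ) < s₁ + s₂ → |μ i| ≤ γ) (hγ0 : 0 ≤ γ)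
    (h0 : ∀ i : Fin n, s₁ + s₂ ≤ (i : ℕ) → μ i = 0) :
    ‖∑ i ∈ tailIdx n s₁, μ i • x i‖ ≤ s₂ * (γ * κ) := by
  have h1 : ∑ i ∈ tailIdx n s₁, μ i • x i
      = ∑ i ∈ Finset.univ.filter (fun i : Fin n => s₁ ≤ (i : ℕ) ∧ (i : ℕ) < s₁ + s₂),
        μ i • x i := by
    symm
    refine Finset.sum_subset (fun i hi => ?_) fun i hi hi' => ?_
    · simp only [Finset.mem_filter, Finset.mem_univ, true_and] at hi
      exact mem_tailIdx.2 hi.1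
    · have h2 := mem_tailIdx.1 hi
      simp only [Finset.mem_filter, Finset.mem_univ, true_and, not_and, not_lt] at hi'
      rw [h0 i (hi' h2), zero_smul]
  rw [h1]
  refine (norm_sum_le_of_le _ (f := fun i => μ i • x i) (n := fun _ => γ * κ) fun i hi => ?_).trans ?_
  · simp only [Finset.mem_filter, Finset.mem_univ, true_and] at hi
    rw [norm_smul, Real.norm_eq_abs]
    exact mul_le_mul (hγ i hi.1 hi.2) (hx i) (norm_nonneg _) hγ0
  · rw [Finset.sum_const, nsmul_eq_mul]
    gcongr
    exact_mod_cast card_filter_Ico_le n s₁ s₂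

theorem olsOn_eq_add_gramSolve {n d : ℕ} {x : Fin n → EuclideanSpace ℝ (Fin d)}
    {I : Finset (Fin n)} (hI : (gramOn x I).PosDef) (μ ε : Fin n → ℝ)
    (β : EuclideanSpace ℝ (Fin d)) :
    olsOn x (fun i => μ i + inner ℝ (x i) β + ε i) I
      = β + gramSolve x I (∑ i ∈ I, ε i • x i + ∑ i ∈ I, μ i • x i) := by
  have hβ : β = gramSolve x I (WithLp.toLp 2 (gramOn x I *ᵥ β.ofLp)) := eq_gramSolve hI _ _ rfl
  nth_rewrite 2 [hβ]
  rw [← gramSolve_add]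
  simp only [olsOn, gramSolve]
  congr 2
  ext j
  have h1 : (gramOn x I *ᵥ β.ofLp) j = ∑ i ∈ I, inner ℝ (x i) β * x i j := by
    simp only [Matrix.mulVec, dotProduct, gramOn, Matrix.of_apply, Finset.sum_mul,
      PiLp.inner_apply, RCLike.inner_apply, conj_trivial]
    rw [Finset.sum_comm]
    exact Finset.sum_congr rfl fun i _ => Finset.sum_congr rfl fun k _ => by ring
  simp only [WithLp.ofLp_add, Pi.add_apply, h1, WithLp.ofLp_sum, WithLp.ofLp_smul,
    Finset.sum_apply, Pi.smul_apply, smul_eq_mul, ← Finset.sum_add_distrib]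
  exact Finset.sum_congr rfl fun i _ => by ring

/-! ### High-probability bounds in the model. -/

namespace IncidentalModel

variable {Ω : ℕ → Type*} [∀ n, MeasurableSpace (Ω n)] {P : ∀ n, Measure (Ω n)}
  {M : IncidentalModel Ω}

theorem Standing.covX_apply (hM : M.Standing P) (n : ℕ) (j k : Fin (M.d n)) :
    M.covX n j k = ∫ x, x j * x k ∂M.lawX n := by
  have := hM.prob_lawX n
  have h := covariance_eq_sub (hM.memLp_X n j) (hM.memLp_X n k)
  simp only [hM.mean_X, mul_zero, sub_zero] at h
  exact h

theorem Standing.covX_transpose (hM : M.Standing P) (n : ℕ) : (M.covX n)ᵀ = M.covX n := by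
  have := (hM.posDef_covX n).isHermitian
  rwa [Matrix.IsHermitian, Matrix.conjTranspose_eq_transpose_of_trivial] at this

theorem Standing.exists_covX_lower (hM : M.Standing P) (hB1 : M.AssumptionB1') :
    ∃ c : ℝ, 0 < c ∧ ∀ n, ∀ v : EuclideanSpace ℝ (Fin (M.d n)),
      c * ‖v‖ ^ 2 ≤ v.ofLp ⬝ᵥ (M.covX n *ᵥ v.ofLp) := by
  obtain ⟨c, hc, h⟩ := hB1
  exact ⟨c, hc, fun n v => le_dotProduct_of_eigenvalues (hM.covX_transpose n) (h n) v⟩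

theorem Standing.eventually_d_pos (hM : M.Standing P) : ∀ᶠ n in atTop, 0 < M.d n :=
  hM.d_tendsto.eventually_gt_atTop 0

theorem Standing.exists_fourthSum_le (hM : M.Standing P) (hC : M.AssumptionC) :
    ∃ C : ℝ, 0 < C ∧ ∀ᶠ n in atTop, fourthSum (M.lawX n) ≤ C * M.d n := by
  obtain ⟨C, h⟩ := hC.2
  refine ⟨max C 1, by positivity, ?_⟩
  filter_upwards [hM.eventually_d_pos] with n hn
  have hn' : (0 : ℝ) < M.d n := by exact_mod_cast hn
  have h1 := h n
  rw [inv_mul_le_iff₀ hn'] at h1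
  rw [fourthSum]
  nlinarith [le_max_left C 1]

theorem fourthSum_nonneg {d : ℕ} (ν : Measure (EuclideanSpace ℝ (Fin d))) : 0 ≤ fourthSum ν :=
  Finset.sum_nonneg fun _ _ => Real.sqrt_nonneg _

/-- Powers of the dimension up to the eighth are negligible. -/
theorem Standing.tendsto_d_pow_div (hM : M.Standing P)
    (hd8 : (fun n => (M.d n : ℝ) ^ 8 * Real.log (M.d n) ^ 2) =o[atTop] fun n => (n : ℝ))
    {k : ℕ} (hk : k ≤ 8) : Tendsto (fun n => (M.d n : ℝ) ^ k / n) atTop (𝓝 0) := by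
  have h1 : Tendsto (fun n => (M.d n : ℝ) ^ 8 * Real.log (M.d n) ^ 2 / n) atTop (𝓝 0) :=
    hd8.tendsto_div_nhds_zero
  refine squeeze_zero' (Eventually.of_forall fun n => by positivity) ?_ h1
  have hlog : Tendsto (fun n => Real.log (M.d n)) atTop atTop :=
    Real.tendsto_log_atTop.comp (tendsto_natCast_atTop_atTop.comp hM.d_tendsto)
  filter_upwards [hlog.eventually_ge_atTop 1, hM.eventually_d_pos] with n hl hd
  have hd' : (1 : ℝ) ≤ M.d n := by exact_mod_cast hd
  gcongr
  calc (M.d n : ℝ) ^ k ≤ (M.d n : ℝ) ^ 8 * 1 := by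
        rw [mul_one]; exact pow_le_pow_right₀ hd' hk
    _ ≤ _ := by
        gcongr
        nlinarith

theorem Standing.whp_norm_X_le (hM : M.Standing P) : WHP P fun n ω => ∀ i, ‖M.X n i ω‖ ≤ M.κ n := by
  have h := hM.max_X
  unfold WHP
  simpa using h

theorem Standing.whp_abs_ε_le (hM : M.Standing P) : WHP P fun n ω => ∀ i, |M.ε n i ω| ≤ M.γ n := by
  have h := hM.max_ε
  unfold WHP
  simpa using h

variable [∀ n, IsProbabilityMeasure (P n)]

theorem Standing.whp_gram_deviation (hM : M.Standing P) (hC : M.AssumptionC)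
    (hd : Tendsto (fun n => (M.d n : ℝ) ^ 2 / n) atTop (𝓝 0)) (I : ∀ n, Finset (Fin n))
    {δ : ℝ} (hδ : 0 < δ) :
    WHP P fun n ω => √(∑ p : Fin (M.d n) × Fin (M.d n), (∑ i ∈ I n,
      (M.sampleX n ω i p.1 * M.sampleX n ω i p.2 - M.covX n p.1 p.2)) ^ 2) ≤ δ * n := by
  obtain ⟨C, hC0, hCd⟩ := hM.exists_fourthSum_le hC
  refine WHP.of_le_ofReal (u := fun n => C ^ 2 / δ ^ 2 * ((M.d n : ℝ) ^ 2 / n))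
    (by simpa using hd.const_mul (C ^ 2 / δ ^ 2)) ?_
  filter_upwards [hCd, eventually_gt_atTop 0] with n hn hn0
  have hn0' : (0 : ℝ) < n := by exact_mod_cast hn0
  have := hM.prob_lawX n
  refine ((measure_mono fun ω hω => ?_).trans (measure_gram_deviation_le (hM.hasLaw_X n)
    (hM.indep_X n) (hC.1 n) (I n) (t := (δ * n) ^ 2) (by positivity))).trans
    (ENNReal.ofReal_le_ofReal ?_)
  · simp only [Set.mem_ofPred_eq, not_le, hM.covX_apply] at hω ⊢
    exact ((Real.lt_sqrt (by positivity)).1 hω).le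
  · have h1 : ((I n).card : ℝ) ≤ n := by
      exact_mod_cast (Finset.card_le_univ (I n)).trans (by simp)
    have h2 := fourthSum_nonneg (M.lawX n)
    calc ((I n).card : ℝ) * fourthSum (M.lawX n) ^ 2 / (δ * n) ^ 2
        ≤ n * (C * M.d n) ^ 2 / (δ * n) ^ 2 := by gcongr
      _ = _ := by field_simp

/-- The constant `c` is chosen before `η`, so later tolerances may depend on it. -/
theorem Standing.exists_whp_gram (hM : M.Standing P) (hB1 : M.AssumptionB1') (hC : M.AssumptionC)
    (hd : Tendsto (fun n => (M.d n : ℝ) ^ 2 / n) atTop (𝓝 0)) :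
    ∃ c : ℝ, 0 < c ∧ ∀ η : ℝ, 0 < η → η ≤ 1 / 2 → WHP P fun n ω =>
      (∀ v, c * n * ‖v‖ ^ 2 ≤ ∑ i ∈ tailIdx n (M.s₁ n), inner ℝ (M.sampleX n ω i) v ^ 2) ∧
      ∀ v, (1 - η) * ∑ i, inner ℝ (M.sampleX n ω i) v ^ 2
        ≤ ∑ i ∈ tailIdx n (M.s₁ n), inner ℝ (M.sampleX n ω i) v ^ 2 := by
  obtain ⟨c, hc, hS⟩ := hM.exists_covX_lower hB1
  refine ⟨c / 4, by positivity, fun η hη hη1 => ?_⟩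
  have hs := hM.s₁_small.def (show 0 < η / 4 by positivity)
  refine ((hM.whp_gram_deviation hC hd (fun n => Finset.univ) (δ := η * c / 4) (by positivity)).and
    (hM.whp_gram_deviation hC hd (fun n => (tailIdx n (M.s₁ n))ᶜ) (δ := η * c / 4)
      (by positivity))).mono ?_
  filter_upwards [hs] with n hn ω hω
  simp only [Real.norm_natCast] at hn
  exact gram_compare hc hη hη1 (hS n) (card_compl_tailIdx_le _ _) hn hω.1 hω.2

/-- This bound is the partner of the sign score, of size `d √n`: their product is of order `n`, free
of `κ_n`. The failure probability is of order `d⁶ / n`. -/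
theorem Standing.whp_norm_X_le_sqrt_div (hM : M.Standing P) (hC : M.AssumptionC)
    (hd : Tendsto (fun n => (M.d n : ℝ) ^ 6 / n) atTop (𝓝 0)) :
    WHP P fun n ω => ∀ i, ‖M.X n i ω‖ ≤ √(n : ℝ) / M.d n := by
  obtain ⟨C, hC0, hCd⟩ := hM.exists_fourthSum_le hC
  refine WHP.of_le_ofReal (u := fun n => C ^ 2 * ((M.d n : ℝ) ^ 6 / n))
    (by simpa using hd.const_mul (C ^ 2)) ?_
  filter_upwards [hCd, eventually_gt_atTop 0, hM.eventually_d_pos] with n hn hn0 hd0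
  have hn0' : (0 : ℝ) < n := by exact_mod_cast hn0
  have hd0' : (0 : ℝ) < M.d n := by exact_mod_cast hd0
  simp only [not_forall, not_le]
  refine (measure_exists_lt_norm_le (hM.hasLaw_X n) (hC.1 n) (by positivity)).trans
    (ENNReal.ofReal_le_ofReal ?_)
  have h2 := fourthSum_nonneg (M.lawX n)
  have h3 : √(n : ℝ) ^ 4 = (n : ℝ) ^ 2 := by
    rw [show √(n : ℝ) ^ 4 = (√(n : ℝ) ^ 2) ^ 2 by ring, Real.sq_sqrt hn0'.le]
  calc (n : ℝ) * fourthSum (M.lawX n) ^ 2 / (√(n : ℝ) / M.d n) ^ 4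
      ≤ n * (C * M.d n) ^ 2 / (√(n : ℝ) / M.d n) ^ 4 := by gcongr
    _ = _ := by rw [div_pow, h3]; field_simp

/-- The sum has typical size at most of order `√(n d)`; the spare factor `√d` gives a failure
probability of order `1 / d`. -/
theorem Standing.whp_norm_sum_sign_le (hM : M.Standing P) (hC : M.AssumptionC)
    (I : ∀ n, Finset (Fin n)) {ρ : ℝ} (hρ : 0 < ρ) :
    WHP P fun n ω => ‖∑ i ∈ I n, (M.μStar n i).sign • M.X n i ω‖ ≤ ρ * (M.d n * √(n : ℝ)) := by
  obtain ⟨C, hC0, hCd⟩ := hM.exists_fourthSum_le hC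
  refine WHP.of_le_ofReal (u := fun n => C / ρ ^ 2 * (M.d n : ℝ)⁻¹)
    (by simpa using (tendsto_inv_atTop_zero.comp
      (tendsto_natCast_atTop_atTop.comp hM.d_tendsto)).const_mul (C / ρ ^ 2)) ?_
  filter_upwards [hCd, eventually_gt_atTop 0, hM.eventually_d_pos] with n hn hn0 hd0
  have hn0' : (0 : ℝ) < n := by exact_mod_cast hn0
  have hd0' : (0 : ℝ) < M.d n := by exact_mod_cast hd0
  have := hM.prob_lawX n
  refine ((measure_mono fun ω hω => ?_).trans (measure_norm_sum_smul_le (hM.hasLaw_X n)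
    (hM.indep_X n) (hC.1 n) (hM.mean_X n) (I n) (fun i => (M.μStar n i).sign) (fun i => ?_)
    (t := ρ * (M.d n * √(n : ℝ))) (by positivity))).trans (ENNReal.ofReal_le_ofReal ?_)
  · simp only [Set.mem_ofPred_eq, not_le] at hω ⊢
    exact hω.le
  · rcases Real.sign_apply_eq (M.μStar n i) with h | h | h <;> simp [h]
  · have h1 : ((I n).card : ℝ) ≤ n := by
      exact_mod_cast (Finset.card_le_univ (I n)).trans (by simp)
    have h2 := fourthSum_nonneg (M.lawX n)
    calc ((I n).card : ℝ) * fourthSum (M.lawX n) / (ρ * (M.d n * √(n : ℝ))) ^ 2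
        ≤ n * (C * M.d n) / (ρ * (M.d n * √(n : ℝ))) ^ 2 := by gcongr
      _ = _ := by
        rw [mul_pow, mul_pow, Real.sq_sqrt hn0'.le]; field_simp

/-- The threshold is chosen so that multiplying it by the covariate bound `κ_n` leaves `ρ λ n`. -/
theorem Standing.whp_norm_sum_noise_le (hM : M.Standing P) (hlam : M.RegSpec)
    (hlam0 : ∀ n, 0 < M.lam n) (hC : M.AssumptionC)
    (I : ∀ n, Finset (Fin n)) {ρ : ℝ} (hρ : 0 < ρ) :
    WHP P fun n ω => ‖∑ i ∈ I n, M.ε n i ω • M.X n i ω‖ ≤ ρ * (M.lam n * n / M.κ n) := by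
  obtain ⟨C, hC0, hCd⟩ := hM.exists_fourthSum_le hC
  have hlim := hlam.lower.tendsto_div_nhds_zero
  have hinv : Tendsto (fun n : ℕ => (n : ℝ)⁻¹) atTop (𝓝 0) :=
    tendsto_inv_atTop_zero.comp tendsto_natCast_atTop_atTop
  refine WHP.of_le_ofReal (u := fun n => M.σ ^ 2 * C / ρ ^ 2 *
    ((√(M.d n : ℝ) * M.κ n / M.lam n) ^ 2 * (n : ℝ)⁻¹))
    (by simpa using ((hlim.pow 2).mul hinv).const_mul (M.σ ^ 2 * C / ρ ^ 2)) ?_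
  filter_upwards [hCd, eventually_gt_atTop 0, hM.eventually_d_pos] with n hn hn0 hd0
  have hn0' : (0 : ℝ) < n := by exact_mod_cast hn0
  have hd0' : (0 : ℝ) < M.d n := by exact_mod_cast hd0
  have hκ := hM.κ_pos n
  have hl := hlam0 n
  have := hM.prob_lawX n
  have := hM.prob_lawε
  have hvar : ∫ e, e ^ 2 ∂M.lawε = M.σ ^ 2 := by
    rw [← hM.var_ε, variance_of_integral_eq_zero aemeasurable_id (by simpa using hM.mean_ε)]
    rfl
  refine ((measure_mono fun ω hω => ?_).trans (measure_norm_sum_noise_le (hM.hasLaw_X n)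
    (hM.indep_X n) (hC.1 n) (hM.mean_X n) (hM.hasLaw_ε n) (hM.indep_X_ε n) hM.memLp_ε hvar (I n)
    (t := ρ * (M.lam n * n / M.κ n)) (by positivity))).trans (ENNReal.ofReal_le_ofReal ?_)
  · simp only [Set.mem_ofPred_eq, not_le] at hω ⊢
    exact hω.le
  · have h1 : ((I n).card : ℝ) ≤ n := by
      exact_mod_cast (Finset.card_le_univ (I n)).trans (by simp)
    have h2 := fourthSum_nonneg (M.lawX n)
    calc ((I n).card : ℝ) * (M.σ ^ 2 * fourthSum (M.lawX n)) / (ρ * (M.lam n * n / M.κ n)) ^ 2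
        ≤ n * (M.σ ^ 2 * (C * M.d n)) / (ρ * (M.lam n * n / M.κ n)) ^ 2 := by gcongr
      _ = _ := by
        rw [div_pow (√(M.d n : ℝ) * M.κ n), mul_pow √(M.d n : ℝ), Real.sq_sqrt hd0'.le]
        field_simp

end IncidentalModel

/-! ### Explicit form of the estimators and asymptotic normality. -/

namespace IncidentalModel

variable {Ω : ℕ → Type*} [∀ n, MeasurableSpace (Ω n)] {P : ∀ n, Measure (Ω n)}
  {M : IncidentalModel Ω}

/-- The part of the score at the truth that is due to the errors. -/
def noiseScore (M : IncidentalModel Ω) (n : ℕ) (ω : Ω n) : EuclideanSpace ℝ (Fin (M.d n)) :=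
  ∑ i ∈ tailIdx n (M.s₁ n), M.ε n i ω • M.X n i ω

/-- The part of the score that is due to the bounded incidental parameters. -/
def boundedScore (M : IncidentalModel Ω) (n : ℕ) (ω : Ω n) : EuclideanSpace ℝ (Fin (M.d n)) :=
  ∑ i ∈ tailIdx n (M.s₁ n), M.μStar n i • M.X n i ω

/-- The part of the score that is due to the large incidental parameters. -/
def signScore (M : IncidentalModel Ω) (n : ℕ) (ω : Ω n) : EuclideanSpace ℝ (Fin (M.d n)) :=
  ∑ i ∈ (tailIdx n (M.s₁ n))ᶜ, (M.μStar n i).sign • M.X n i ω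

theorem Standing.lam_pos (hM : M.Standing P) (hlam : M.RegSpec) (n : ℕ) : 0 < M.lam n := by
  obtain ⟨α, hα, h⟩ := hlam.ratio
  have := hM.γ_pos n
  exact lt_of_lt_of_le (by positivity) (h n)

theorem Standing.abs_μStar_le (hM : M.Standing P) (n : ℕ) (i : Fin n)
    (hi : M.s₁ n ≤ (i : ℕ)) : |M.μStar n i| ≤ M.γ n := by
  rcases lt_or_ge (i : ℕ) (M.s₁ n + M.s₂ n) with h | h
  · exact (hM.bounded n i hi h).2
  · rw [hM.zero n i h, abs_zero]
    exact (hM.γ_pos n).le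

theorem Standing.norm_boundedScore_le (hM : M.Standing P) {n : ℕ} {ω : Ω n}
    (hx : ∀ i, ‖M.X n i ω‖ ≤ M.κ n) :
    ‖M.boundedScore n ω‖ ≤ M.s₂ n * (M.γ n * M.κ n) :=
  norm_sum_smul_tailIdx_le (x := M.sampleX n ω) (hM.κ_pos n).le hx
    (fun i hi _ => hM.abs_μStar_le n i hi) (hM.γ_pos n).le (hM.zero n)

theorem Standing.norm_signScore_le (hM : M.Standing P) {n : ℕ} {ω : Ω n}
    (hx : ∀ i, ‖M.X n i ω‖ ≤ M.κ n) : ‖M.signScore n ω‖ ≤ M.s₁ n * M.κ n := by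
  refine (norm_sum_le_of_le _ (n := fun _ => M.κ n) fun i _ => ?_).trans ?_
  · rw [norm_smul, Real.norm_eq_abs]
    have h1 : |(M.μStar n i).sign| ≤ 1 := by
      rcases Real.sign_apply_eq (M.μStar n i) with h | h | h <;> simp [h]
    calc _ ≤ 1 * M.κ n := mul_le_mul h1 (hx i) (norm_nonneg _) zero_le_one
      _ = _ := one_mul _
  · rw [Finset.sum_const, nsmul_eq_mul]
    have := hM.κ_pos n
    gcongr
    exact_mod_cast card_compl_tailIdx_le n (M.s₁ n)

theorem Standing.eventually_bounded_small (hM : M.Standing P)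
    (hs₂ : (fun n => (M.s₂ n : ℝ)) =o[atTop]
      fun n => √(n : ℝ) / (√(M.d n : ℝ) * M.κ n * M.γ n)) {ρ : ℝ} (hρ : 0 < ρ) :
    ∀ᶠ n in atTop, (M.s₂ n : ℝ) * (M.γ n * M.κ n) ≤ ρ * √(n : ℝ) := by
  filter_upwards [hs₂.def hρ, hM.eventually_d_pos] with n hn hd
  have hκ := hM.κ_pos n
  have hγ := hM.γ_pos n
  have hd1 : (1 : ℝ) ≤ √(M.d n : ℝ) := by
    rw [Real.one_le_sqrt]; exact_mod_cast hd
  rw [Real.norm_natCast, Real.norm_of_nonneg (by positivity)] at hn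
  calc (M.s₂ n : ℝ) * (M.γ n * M.κ n)
      ≤ ρ * (√(n : ℝ) / (√(M.d n : ℝ) * M.κ n * M.γ n)) * (M.γ n * M.κ n) := by gcongr
    _ = ρ * √(n : ℝ) / √(M.d n : ℝ) := by field_simp
    _ ≤ ρ * √(n : ℝ) := div_le_self (by positivity) hd1

theorem Standing.eventually_sign_small (hM : M.Standing P) (hlam : M.RegSpec)
    (hs₁ : (fun n => (M.s₁ n : ℝ)) =o[atTop]
      fun n => √(n : ℝ) / (M.lam n * √(M.d n : ℝ) * M.κ n)) {ρ : ℝ} (hρ : 0 < ρ) :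
    ∀ᶠ n in atTop, M.lam n * (M.s₁ n * M.κ n) ≤ ρ * √(n : ℝ) := by
  filter_upwards [hs₁.def hρ, hM.eventually_d_pos] with n hn hd
  have hκ := hM.κ_pos n
  have hl := hM.lam_pos hlam n
  have hd1 : (1 : ℝ) ≤ √(M.d n : ℝ) := by
    rw [Real.one_le_sqrt]; exact_mod_cast hd
  rw [Real.norm_natCast, Real.norm_of_nonneg (by positivity)] at hn
  calc M.lam n * (M.s₁ n * M.κ n)
      ≤ M.lam n * (ρ * (√(n : ℝ) / (M.lam n * √(M.d n : ℝ) * M.κ n)) * M.κ n) := by gcongr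
    _ = ρ * √(n : ℝ) / √(M.d n : ℝ) := by field_simp
    _ ≤ ρ * √(n : ℝ) := div_le_self (by positivity) hd1

theorem Standing.aemeasurable_sampleX (hM : M.Standing P) (n : ℕ) :
    AEMeasurable (M.sampleX n) (P n) :=
  aemeasurable_pi_lambda _ fun i => (hM.hasLaw_X n i).aemeasurable

theorem Standing.aemeasurable_Y (hM : M.Standing P) (n : ℕ) :
    AEMeasurable (M.Y n) (P n) := by
  refine aemeasurable_pi_lambda _ fun i => ?_
  have h1 := (hM.hasLaw_X n i).aemeasurable
  have h2 := (hM.hasLaw_ε n i).aemeasurable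
  unfold Y
  fun_prop

theorem Standing.aemeasurable_twoStep (hM : M.Standing P) (n : ℕ) {m : Ω n → Fin n → ℝ}
    (hm : AEMeasurable m (P n)) :
    AEMeasurable (fun ω => twoStep (M.sampleX n ω) (M.Y n ω) (m ω)) (P n) := by
  have h := (measurable_twoStep (n := n) (d := M.d n)).comp_aemeasurable
    ((hM.aemeasurable_sampleX n).prodMk ((hM.aemeasurable_Y n).prodMk hm))
  have e : (fun ω => twoStep (M.sampleX n ω) (M.Y n ω) (m ω))
      = (fun z : (Fin n → EuclideanSpace ℝ (Fin (M.d n))) × (Fin n → ℝ) × (Fin n → ℝ) =>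
        twoStep z.1 z.2.1 z.2.2) ∘ fun ω => (M.sampleX n ω, M.Y n ω, m ω) := by
    ext1 ω
    simp only [Function.comp_apply]
  rw [e]
  exact h

variable [∀ n, IsProbabilityMeasure (P n)]

/-- With probability tending to one the penalized estimators have an explicit form: the estimated
incidental parameters vanish exactly on `tailIdx n s₁`. -/
theorem Standing.whp_penMinimizer_eq (hM : M.Standing P) (hlam : M.RegSpec)
    (hB1 : M.AssumptionB1') (hC : M.AssumptionC)
    (hs₂ : (fun n => (M.s₂ n : ℝ)) =o[atTop]
      fun n => √(n : ℝ) / (√(M.d n : ℝ) * M.κ n * M.γ n))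
    (hd8 : (fun n => (M.d n : ℝ) ^ 8 * Real.log (M.d n) ^ 2) =o[atTop] fun n => (n : ℝ))
    {μhat : ∀ n, Ω n → Fin n → ℝ} {βhat : ∀ n, Ω n → EuclideanSpace ℝ (Fin (M.d n))}
    (hmin : WHP P fun n ω => IsPenMinimizer (M.sampleX n ω) (M.Y n ω) (M.lam n)
      (μhat n ω) (βhat n ω)) :
    WHP P fun n ω => βhat n ω = M.βStar n + gramSolve (M.sampleX n ω) (tailIdx n (M.s₁ n))
        (M.noiseScore n ω + (M.boundedScore n ω + M.lam n • M.signScore n ω)) ∧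
      ∀ i, μhat n ω i = 0 ↔ i ∈ tailIdx n (M.s₁ n) := by
  obtain ⟨c, hc, hgram⟩ := hM.exists_whp_gram hB1 hC (hM.tendsto_d_pow_div hd8 (by norm_num))
  obtain ⟨α, hα, hratio⟩ := hlam.ratio
  have hα0 : 0 < α := by linarith
  -- On `I`, `|μ_i + ε_i| ≤ 2γ ≤ (2/α) λ`. Fitted values may use half of the remaining room below
  -- `λ`.
  set θ : ℝ := (1 - 2 / α) / 2 with hθ
  have hα2 : 2 / α < 1 := by rw [div_lt_one hα0]; exact hα
  have hα2' : 0 < 2 / α := by positivity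
  have hθ0 : 0 < θ := by rw [hθ]; linarith
  have hθ1 : θ < 1 := by rw [hθ]; linarith
  -- Each of the three scores may contribute `θ λ / 3`, after division by the Gram lower bound `c
  -- n`.
  set ρ : ℝ := c * θ / 3 with hρ
  have hρ0 : 0 < ρ := by positivity
  refine ((((hgram (1 / 2) (by norm_num) le_rfl).and hM.whp_norm_X_le).and
    (hM.whp_abs_ε_le.and (hM.whp_norm_X_le_sqrt_div hC
      (hM.tendsto_d_pow_div hd8 (by norm_num))))).and
    (((hM.whp_norm_sum_sign_le hC (fun n => (tailIdx n (M.s₁ n))ᶜ) hρ0).and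
    (hM.whp_norm_sum_noise_le hlam (hM.lam_pos hlam) hC (fun n => tailIdx n (M.s₁ n)) hρ0)).and
    hmin)).mono ?_
  -- The factor 4 suffices off `I`, since `|ε_i| + θ λ + λ < 5 λ / 2`.
  filter_upwards [hM.eventually_bounded_small hs₂ one_pos, hlam.lower.def hρ0, hlam.upper 4,
    eventually_gt_atTop 0, hM.eventually_d_pos] with n hn1 hn2 hn3 hn0 hd0
  rintro ω ⟨⟨⟨⟨hlow, -⟩, hXκ⟩, hεγ, hXd⟩, ⟨hsign, hnoise⟩, hmin⟩
  have hn0' : (1 : ℝ) ≤ n := by exact_mod_cast hn0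
  have hd0' : (1 : ℝ) ≤ M.d n := by exact_mod_cast hd0
  have hκ := hM.κ_pos n
  have hγ := hM.γ_pos n
  have hl := hM.lam_pos hlam n
  have hcn : 0 < c * n := by positivity
  have hpd := gramOn_posDef (M.sampleX n ω) _ hcn hlow
  have hd1 : (1 : ℝ) ≤ √(M.d n : ℝ) := by rwa [Real.one_le_sqrt]
  rw [Real.norm_of_nonneg (by positivity), Real.norm_of_nonneg hl.le] at hn2
  have hκρ : M.κ n ≤ ρ * M.lam n := le_trans (by nlinarith) hn2
  have hratio' : 2 * M.γ n ≤ 2 / α * M.lam n := by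
    rw [div_mul_eq_mul_div, le_div_iff₀ hα0]
    linarith [hratio n]
  have hγl : 2 * M.γ n ≤ M.lam n := hratio'.trans (by nlinarith)
  have hsqrt : √(n : ℝ) ≤ n := by
    rw [Real.sqrt_le_left (by positivity)]; nlinarith
  have hsq : √(n : ℝ) * √(n : ℝ) = n := Real.mul_self_sqrt (by positivity)
  set I := tailIdx n (M.s₁ n) with hI
  -- It is used with the pairs `(κ, ρλn/κ)` for the errors, `(κ, √n)` for the bounded parameters,
  -- and `(√n/d, λρd√n)` for the signs.
  have hinner : ∀ (i : Fin n) (a : EuclideanSpace ℝ (Fin (M.d n))) (k r : ℝ),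
      ‖M.X n i ω‖ ≤ k → ‖a‖ ≤ r → k * r ≤ ρ * M.lam n * n →
      |inner ℝ (M.sampleX n ω i) (gramSolve (M.sampleX n ω) I a)| ≤ θ / 3 * M.lam n := by
    intro i a k r hk hr hkr
    have hk0 := (norm_nonneg _).trans hk
    calc |inner ℝ (M.sampleX n ω i) (gramSolve (M.sampleX n ω) I a)|
        ≤ ‖M.X n i ω‖ * ‖gramSolve (M.sampleX n ω) I a‖ := abs_real_inner_le_norm _ _
      _ ≤ k * (r / (c * n)) := by
          gcongr
          exact (norm_gramSolve_le hcn hlow a).trans (by gcongr)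
      _ = k * r / (c * n) := by ring
      _ ≤ ρ * M.lam n * n / (c * n) := by gcongr
      _ = θ / 3 * M.lam n := by rw [hρ]; field_simp
  have key := IsPenMinimizer.eq_of_separation (x := M.sampleX n ω) (μ := M.μStar n)
    (ε := fun i => M.ε n i ω) (l := M.lam n) (θ := θ * M.lam n) (m := μhat n ω) (b := βhat n ω)
    (β := M.βStar n) (δ := gramSolve (M.sampleX n ω) I
      (M.noiseScore n ω + (M.boundedScore n ω + M.lam n • M.signScore n ω))) I hl ?_ ?_ ?_ ?_ ?_
    hmin
  · exact key
  · intro w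
    rw [gramSolve_spec hpd]
    simp only [noiseScore, boundedScore, signScore, inner_add_left, sum_inner, inner_smul_left,
      conj_trivial, Finset.mul_sum, add_mul, Finset.sum_add_distrib, sampleX]
    have : ∀ i, M.lam n * ((M.μStar n i).sign * inner ℝ (M.X n i ω) w)
        = M.lam n * (M.μStar n i).sign * inner ℝ (M.X n i ω) w := fun i => by ring
    simp only [this]
    ring
  · intro i
    rw [gramSolve_add, gramSolve_add, inner_add_right, inner_add_right]
    have b1 := hinner i (M.noiseScore n ω) _ _ (hXκ i) hnoise
      (le_of_eq (by field_simp))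
    have b2 := hinner i (M.boundedScore n ω) _ _ (hXκ i)
      ((hM.norm_boundedScore_le hXκ).trans hn1) (by
        rw [one_mul]
        exact mul_le_mul hκρ hsqrt (by positivity) (by positivity))
    have b3 := hinner i (M.lam n • M.signScore n ω) _ (M.lam n * (ρ * (M.d n * √(n : ℝ)))) (hXd i)
      (by
        rw [norm_smul, Real.norm_of_nonneg hl.le]
        exact mul_le_mul_of_nonneg_left hsign hl.le)
      (le_of_eq (by
        field_simp
        rw [sq, hsq]))
    refine (abs_add_le _ _).trans ?_
    have := abs_add_le (inner ℝ (M.sampleX n ω i) (gramSolve (M.sampleX n ω) I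
      (M.boundedScore n ω))) (inner ℝ (M.sampleX n ω i) (gramSolve (M.sampleX n ω) I
      (M.lam n • M.signScore n ω)))
    linarith
  · intro i hi
    have h1 := hM.abs_μStar_le n i (mem_tailIdx.1 hi)
    have h2 := abs_add_le (M.μStar n i) (M.ε n i ω)
    have h3 := hεγ i
    have h4 : θ * M.lam n = M.lam n / 2 - 2 / α * M.lam n / 2 := by rw [hθ]; ring
    have h5 : 2 / α * M.lam n < M.lam n := by nlinarith
    linarith
  · intro i hi
    have h1 := hn3 i (not_le.1 fun h => Finset.mem_compl.1 hi (mem_tailIdx.2 h))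
    have h3 := hεγ i
    have h4 : θ * M.lam n < M.lam n := by nlinarith
    linarith
  · intro v hv
    have h1 := hlow v
    rw [Finset.sum_eq_zero fun i hi => by rw [hv i hi]; norm_num] at h1
    have h2 : ‖v‖ ^ 2 ≤ 0 := by
      by_contra h
      push Not at h
      nlinarith
    exact norm_eq_zero.1 (pow_eq_zero_iff two_ne_zero |>.1 (le_antisymm h2 (sq_nonneg _)))

/-- Asymptotic normality of a studentized estimator whose error is `gramSolve` applied to the
noise score plus a negligible bias. -/
theorem Standing.tendstoInDistribution_studentized (hM : M.Standing P)
    (hB1 : M.AssumptionB1') (hC : M.AssumptionC)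
    (hd2 : Tendsto (fun n => (M.d n : ℝ) ^ 2 / n) atTop (𝓝 0))
    {q : ℕ} {A : ∀ n, Matrix (Fin q) (Fin (M.d n)) ℝ} (hG : ∀ᶠ n in atTop, (M.GX A n).PosDef)
    {b w : ∀ n, Ω n → EuclideanSpace ℝ (Fin (M.d n))} (hb : ∀ n, AEMeasurable (b n) (P n))
    (hbw : WHP P fun n ω => b n ω = M.βStar n + gramSolve (M.sampleX n ω) (tailIdx n (M.s₁ n))
      (M.noiseScore n ω + w n ω))
    (hw : ∀ ρ > 0, WHP P fun n ω => ‖w n ω‖ ≤ ρ * √(n : ℝ)) :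
    TendstoInDistribution (fun n => M.studentized A n (b n)) atTop id P
      (multivariateGaussian 0 (M.σ ^ 2 • (1 : Matrix (Fin q) (Fin q) ℝ))) := by
  obtain ⟨c, hc, hgram⟩ := hM.exists_whp_gram hB1 hC hd2
  have := hM.prob_lawε
  let z : EuclideanSpace ℝ (Fin q) → ∀ n, (Fin n → EuclideanSpace ℝ (Fin (M.d n))) →
      EuclideanSpace ℝ (Fin (M.d n)) := fun t n x =>
    gramSolve x (tailIdx n (M.s₁ n)) (studDir (A n) x t)
  -- The weights are functions of the covariates alone, hence independent of the errors; they are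
  -- extended by zero off `tailIdx`.
  let cw : EuclideanSpace ℝ (Fin q) → ∀ n, (Fin n → EuclideanSpace ℝ (Fin (M.d n))) →
      Fin n → ℝ := fun t n x i => if i ∈ tailIdx n (M.s₁ n) then inner ℝ (x i) (z t n x) else 0
  have hcw : ∀ t n, Measurable (cw t n) := by
    intro t n
    refine measurable_pi_lambda _ fun i => Measurable.ite (MeasurableSet.const _) ?_
      measurable_const
    have h1 : Measurable (z t n) := measurable_gramSolve_studDir (A n) _ t
    have h2 : Measurable fun x : Fin n → EuclideanSpace ℝ (Fin (M.d n)) => x i :=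
      measurable_pi_apply i
    exact h2.inner h1
  have hplug : ∀ᶠ n in atTop, ∀ ω, (∀ v, c * n * ‖v‖ ^ 2
      ≤ ∑ i ∈ tailIdx n (M.s₁ n), inner ℝ (M.sampleX n ω i) v ^ 2) →
      (plugIn (A n) (M.sampleX n ω)).PosDef := by
    filter_upwards [hG, eventually_gt_atTop 0] with n hGn hn0 ω hlow
    have hn0' : (0 : ℝ) < n := by exact_mod_cast hn0
    refine posDef_mul_inv_mul_transpose hGn ?_
    have hU : (gramOn (M.sampleX n ω) Finset.univ).PosDef :=
      gramOn_posDef _ _ (c := c * n) (by positivity) fun v => (hlow v).trans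
        (Finset.sum_le_sum_of_subset_of_nonneg (Finset.subset_univ _) fun _ _ _ => sq_nonneg _)
    exact hU.smul (by positivity)
  -- a product of a vector of size `O(n^{-1/2})` and a vector of size `o(n^{1/2})` is negligible
  have hprod : ∀ (n : ℕ) (t : EuclideanSpace ℝ (Fin q)) (η r s : ℝ), 0 < n → 0 < η → 0 ≤ r →
      0 ≤ s → r ^ 2 ≤ 2 * ‖t‖ ^ 2 / (c * n) →
      -- The `+ 1` keeps the denominator positive when `t = 0`.
      s ≤ η / √(2 * ‖t‖ ^ 2 / c + 1) * √(n : ℝ) → r * s ≤ η := by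
    intro n t η r s hn0 hη hr hs h1 h2
    have hn0' : (0 : ℝ) < n := by exact_mod_cast hn0
    have hK : 0 < 2 * ‖t‖ ^ 2 / c + 1 := by positivity
    refine (le_abs_self _).trans (abs_le_of_sq_le_sq ?_ hη.le)
    calc (r * s) ^ 2 = r ^ 2 * s ^ 2 := mul_pow _ _ _
      _ ≤ (2 * ‖t‖ ^ 2 / (c * n)) * (η / √(2 * ‖t‖ ^ 2 / c + 1) * √(n : ℝ)) ^ 2 := by gcongr
      _ = (2 * ‖t‖ ^ 2 / c) / (2 * ‖t‖ ^ 2 / c + 1) * η ^ 2 := by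
          rw [mul_pow, div_pow, Real.sq_sqrt hK.le, Real.sq_sqrt hn0'.le]
          field_simp
      _ ≤ 1 * η ^ 2 := by
          gcongr
          rw [div_le_one hK]; linarith
      _ = η ^ 2 := one_mul _
  refine tendstoInDistribution_of_weighted_sum (X := fun n => M.sampleX n) (ε := M.ε) (c := cw)
    hM.memLp_ε hM.mean_ε hM.var_ε hM.aemeasurable_sampleX hM.hasLaw_ε hM.indep_ε hM.indep_X_ε
    (fun n => M.aemeasurable_studentized A n (hM.aemeasurable_sampleX n) (hb n)) hcw ?_ ?_ ?_
  · intro t η hη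
    have hK : 0 < 2 * ‖t‖ ^ 2 / c + 1 := by positivity
    refine (((hgram (1 / 2) (by norm_num) le_rfl).and hbw).and
      (hw (η / √(2 * ‖t‖ ^ 2 / c + 1)) (by positivity))).mono ?_
    filter_upwards [hplug, eventually_gt_atTop 0] with n hn hn0
    rintro ω ⟨⟨⟨hlow, hrel⟩, hbω⟩, hwω⟩
    have hpd := hn ω hlow
    -- Symmetry moves the inverse Gram matrix onto the studentizing direction, leaving a linear
    -- functional of the errors plus a bias.
    have hst : inner ℝ (M.studentized A n (b n) ω) t
        = ∑ i, cw t n (M.sampleX n ω) i * M.ε n i ω + inner ℝ (z t n (M.sampleX n ω)) (w n ω) := by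
      have h1 : inner ℝ (M.studentized A n (b n) ω) t
          = inner ℝ (studDir (A n) (M.sampleX n ω) t) (b n ω - M.βStar n) :=
        inner_toLp_smul_mulVec (invSqrt_transpose _) (A n) _ _ t
      rw [h1, hbω, add_sub_cancel_left, inner_gramSolve_comm, inner_add_right]
      congr 1
      simp only [noiseScore, inner_sum, inner_smul_right, cw, z, ite_mul, zero_mul]
      rw [Finset.sum_ite_mem, Finset.univ_inter]
      refine Finset.sum_congr rfl fun i _ => ?_
      rw [mul_comm, real_inner_comm]
      rfl
    rw [hst, add_sub_cancel_left]
    exact (abs_real_inner_le_norm _ _).trans (hprod n t η _ _ hn0 hη (norm_nonneg _)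
      (norm_nonneg _) (studDir_weights hn0 hpd hc le_rfl hlow hrel t).2 hwω)
  · intro t η hη
    have hK : 0 < 2 * ‖t‖ ^ 2 / c + 1 := by positivity
    refine ((hgram (1 / 2) (by norm_num) le_rfl).and hM.whp_norm_X_le).mono ?_
    filter_upwards [hplug, eventually_gt_atTop 0, hM.κ_small.def
      (show 0 < η / √(2 * ‖t‖ ^ 2 / c + 1) by positivity)] with n hn hn0 hκn
    rintro ω ⟨⟨hlow, hrel⟩, hXκ⟩ i
    have hpd := hn ω hlow
    rw [Real.norm_of_nonneg (hM.κ_pos n).le, Real.norm_of_nonneg (Real.sqrt_nonneg _)] at hκn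
    simp only [cw]
    split_ifs
    · rw [real_inner_comm]
      exact (abs_real_inner_le_norm _ _).trans (hprod n t η _ _ hn0 hη (norm_nonneg _)
        (norm_nonneg _) (studDir_weights hn0 hpd hc le_rfl hlow hrel t).2 ((hXκ i).trans hκn))
    · simpa using hη.le
  · intro t η hη
    have hT : 0 < 2 * ‖t‖ ^ 2 + 1 := by positivity
    refine (hgram (min (1 / 2) (η / (2 * ‖t‖ ^ 2 + 1))) (by positivity) (min_le_left _ _)).mono ?_
    filter_upwards [hplug, eventually_gt_atTop 0] with n hn hn0
    rintro ω ⟨hlow, hrel⟩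
    have hpd := hn ω hlow
    have h1 := (studDir_weights hn0 hpd hc (min_le_left _ _) hlow hrel t).1
    have h2 : ∑ i, cw t n (M.sampleX n ω) i ^ 2 = ∑ i ∈ tailIdx n (M.s₁ n),
        inner ℝ (M.sampleX n ω i) (gramSolve (M.sampleX n ω) (tailIdx n (M.s₁ n))
          (studDir (A n) (M.sampleX n ω) t)) ^ 2 := by
      simp only [cw, z, ite_pow, ne_eq, OfNat.ofNat_ne_zero, not_false_eq_true, zero_pow]
      rw [Finset.sum_ite_mem, Finset.univ_inter]
    rw [h2]
    refine h1.trans ?_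
    calc 2 * min (1 / 2) (η / (2 * ‖t‖ ^ 2 + 1)) * ‖t‖ ^ 2
        ≤ 2 * (η / (2 * ‖t‖ ^ 2 + 1)) * ‖t‖ ^ 2 := by gcongr; exact min_le_right _ _
      _ = η * (2 * ‖t‖ ^ 2 / (2 * ‖t‖ ^ 2 + 1)) := by ring
      _ ≤ η * 1 := by
          gcongr
          rw [div_le_one hT]; linarith
      _ = η := mul_one _

end IncidentalModel

end

theorem theorem5p7 {Ω : ℕ → Type*} [∀ n, MeasurableSpace (Ω n)]
    (P : ∀ n, Measure (Ω n)) [∀ n, IsProbabilityMeasure (P n)]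
    (M : IncidentalModel Ω) (hM : M.Standing P) (hlam : M.RegSpec)
    {q : ℕ} (A : ∀ n, Matrix (Fin q) (Fin (M.d n)) ℝ)
    (hB1 : M.AssumptionB1') (hB2 : M.AssumptionB2) (hC : M.AssumptionC)
    (hD : M.AssumptionD A) (hE : M.AssumptionE)
    -- `G_{X,n}` is invertible for large `n`, so that `G_{X,n}^{-1/2}` makes sense
    (hG : ∀ᶠ n in atTop, (M.GX A n).PosDef)
    (hd5 : (fun n => (M.d n : ℝ) ^ 5 * Real.log (M.d n)) =o[atTop] fun n => (n : ℝ))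
    (hs₂ : (fun n => (M.s₂ n : ℝ)) =o[atTop]
      fun n => √(n : ℝ) / (√(M.d n : ℝ) * M.κ n * M.γ n))
    (hd8 : (fun n => (M.d n : ℝ) ^ 8 * Real.log (M.d n) ^ 2) =o[atTop] fun n => (n : ℝ))
    -- the penalized estimators: with probability tending to one, a minimizer of the criterion
    (μhat : ∀ n, Ω n → Fin n → ℝ)
    (βhat : ∀ n, Ω n → EuclideanSpace ℝ (Fin (M.d n)))
    (hμhat : ∀ n, AEMeasurable (μhat n) (P n))
    (hβhat : ∀ n, AEMeasurable (βhat n) (P n))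
    (hmin : Tendsto (fun n => P n {ω | ¬ IsPenMinimizer (M.sampleX n ω) (M.Y n ω) (M.lam n)
      (μhat n ω) (βhat n ω)}) atTop (𝓝 0)) :
    ((fun n => (M.s₁ n : ℝ)) =o[atTop]
        (fun n => √(n : ℝ) / (M.lam n * √(M.d n : ℝ) * M.κ n)) →
      TendstoInDistribution (fun n => M.studentized A n (βhat n)) atTop id P
        (multivariateGaussian 0 (M.σ ^ 2 • (1 : Matrix (Fin q) (Fin q) ℝ)))) ∧
    TendstoInDistribution
      (fun n => M.studentized A n fun ω => twoStep (M.sampleX n ω) (M.Y n ω) (μhat n ω)) atTop id P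
      (multivariateGaussian 0 (M.σ ^ 2 • (1 : Matrix (Fin q) (Fin q) ℝ))) := by
  have hmin' : WHP P fun n ω => IsPenMinimizer (M.sampleX n ω) (M.Y n ω) (M.lam n)
      (μhat n ω) (βhat n ω) := hmin
  have hest := hM.whp_penMinimizer_eq hlam hB1 hC hs₂ hd8 hmin'
  have hd2 := hM.tendsto_d_pow_div hd8 (k := 2) (by norm_num)
  have hbdd : ∀ ρ > 0, WHP P fun n ω => ‖M.boundedScore n ω‖ ≤ ρ * √(n : ℝ) := fun ρ hρ =>
    hM.whp_norm_X_le.mono (by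
      filter_upwards [hM.eventually_bounded_small hs₂ hρ] with n hn ω hω
      exact (hM.norm_boundedScore_le hω).trans hn)
  constructor
  · intro hs₁
    -- The bias consists of the bounded score and `λ` times the sign score; the condition on `s₁`
    -- makes the latter `o(√n)`.
    refine hM.tendstoInDistribution_studentized hB1 hC hd2 hG hβhat
      (hest.mono (Eventually.of_forall fun n ω h => h.1)) fun ρ hρ => ?_
    refine (hM.whp_norm_X_le.and (hbdd (ρ / 2) (by positivity))).mono ?_
    filter_upwards [hM.eventually_sign_small hlam hs₁ (half_pos hρ)] with n hn ω hω
    have hl := hM.lam_pos hlam n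
    have h1 : ‖M.lam n • M.signScore n ω‖ ≤ ρ / 2 * √(n : ℝ) := by
      rw [norm_smul, Real.norm_of_nonneg hl.le]
      exact (mul_le_mul_of_nonneg_left (hM.norm_signScore_le hω.1) hl.le).trans hn
    have h2 := norm_add_le (M.boundedScore n ω) (M.lam n • M.signScore n ω)
    linarith [hω.2]
  · obtain ⟨c, hc, hgram⟩ := hM.exists_whp_gram hB1 hC hd2
    -- Only the bounded score remains as bias: the estimated zero set is `tailIdx`, so observations
    -- with large parameters are discarded and leave no sign term.
    refine hM.tendstoInDistribution_studentized hB1 hC hd2 hG (w := fun n ω => M.boundedScore n ω)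
      (fun n => hM.aemeasurable_twoStep n (hμhat n)) ?_ hbdd
    · refine ((hgram (1 / 2) (by norm_num) le_rfl).and hest).mono ?_
      filter_upwards [eventually_gt_atTop 0] with n hn0
      rintro ω ⟨⟨hlow, -⟩, -, hzero⟩
      have hn0' : (0 : ℝ) < n := by exact_mod_cast hn0
      have hfilter : (Finset.univ.filter fun i => μhat n ω i = 0) = tailIdx n (M.s₁ n) := by
        ext i
        simp [hzero i]
      have hpd := gramOn_posDef (M.sampleX n ω) (tailIdx n (M.s₁ n)) (by positivity) hlow
      rw [twoStep, hfilter]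
      exact olsOn_eq_add_gramSolve hpd (M.μStar n) (fun i => M.ε n i ω) (M.βStar n)
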